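/- Let $\Sigma$ be an oriented surface, possibly with boundary, possibly disconnected or non-compact. Let $\mathcal{MC}(\Sigma)$ be the set of multi-loops in $\Sigma$, i.e. of finite (possibly empty) collections of pairwise disjoint, simple, non-contractible, unoriented loops, considered up to isotopy; equivalently (Baer, Epstein), two multi-loops are identified when their components can be matched so that corresponding components are freely homotopic up to orientation. Let $D$ be a link diagram on $\Sigma$ with $c(D)$ crossings. A state $S$ of $D$ is a choice of an $A$- or a $B$-smoothing at every crossing (the $A$-smoothing merges the two regions swept out when the over-strand is rotated counterclockwise); we also write $S$ for the resulting collection of disjoint simple loops. Let $a(S)$ and $b(S)$ be the numbers of $A$- and $B$-smoothings in $S$, let $t(S)$ be the number of contractible loops of $S$, and let $\widehat S\in\mathcal{MC}(\Sigma)$ be $S$ with its contractible loops removed. The skein bracket of $D$ is $$[D]_\Sigma=\sum_{S} A^{a(S)-b(S)}\,\delta^{t(S)}\,\widehat S\in \mathbb Z[A^{\pm1}]\mathcal{MC}(\Sigma),\qquad \delta=-A^2-A^{-2},$$ the sum being over all states of $D$. Writing $[D]_\Sigma=\sum_{\mu\in\mathcal{MC}(\Sigma)}p_\mu(D)\,\mu$,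 let $d_{max}([D]_\Sigma)$ and $d_{min}([D]_\Sigma)$ be the maximal and the minimal degree in $A$ of the non-zero $p_\mu(D)$ (with $d_{max}(0)=-\infty$, $d_{min}(0)=+\infty$), and let $\mathrm{span}([D]_\Sigma)=d_{max}([D]_\Sigma)-d_{min}([D]_\Sigma)$ (and $\mathrm{span}(0)=0$). Let $S_A$ and $S_B$ be the states with only $A$-smoothings and only $B$-smoothings. The diagram $D$ is $A$-adequate if every state $S$ which differs from $S_A$ at exactly one crossing satisfies $t(S)\le t(S_A)$ or $\widehat S\ne\widehat S_A$; it is $B$-adequate if every state $S$ which differs from $S_B$ at exactly one crossing satisfies $t(S)\le t(S_B)$ or $\widehat S\ne\widehat S_B$; it is skein adequate if it is both. Then: 1. $d_{max}([D]_\Sigma)\le c(D)+2t(S_A)$, with equality if $D$ is $A$-adequate. 2. $d_{min}([D]_\Sigma)\ge -c(D)-2t(S_B)$, with equality if $D$ is $B$-adequate. 3. $\mathrm{span}([D]_\Sigma)\le 2c(D)+2t(S_A)+2t(S_B)$, with equality if $D$ is skein adequate. 4. If $D$ is $A$-adequate and $S$ is a state with at least one $B$-smoothing, then $a(S)-b(S)+2t(S)<c(D)+2t(S_A)$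 or $\widehat S\ne\widehat S_A$. 5. If $D$ is $B$-adequate and $S$ is a state with at least one $A$-smoothing, then $a(S)-b(S)-2t(S)>-c(D)-2t(S_B)$ or $\widehat S\ne\widehat S_B$. -/

import Mathlib

open scoped unitInterval Manifold ContDiff LaurentPolynomial

noncomputable section

/-! ### Oriented surfaces -/

/-- The Euclidean plane. -/
abbrev Plane : Type := EuclideanSpace ℝ (Fin 2)

/-- An oriented surface, possibly with boundary, possibly disconnected and possibly non-compact:
a smooth 2-manifold with boundary, oriented by an atlas whose coordinate changes all have positive
Jacobian determinant. (The Hausdorff and second countability axioms are separate type classes.) -/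
class OrientedSurface (F : Type*) [TopologicalSpace F] [ChartedSpace (EuclideanHalfSpace 2) F] :
    Prop extends IsManifold (𝓡∂ 2) ∞ F where
  det_pos : ∀ e ∈ atlas (EuclideanHalfSpace 2) F, ∀ e' ∈ atlas (EuclideanHalfSpace 2) F,
    ∀ x ∈ e.source ∩ e'.source,
      0 < (fderivWithin ℝ (e'.extend (𝓡∂ 2) ∘ (e.extend (𝓡∂ 2)).symm) (Set.range (𝓡∂ 2))
        (e.extend (𝓡∂ 2) x)).det

/-- A parametrization `φ : ℝ² → F` is smooth and orientation preserving if in every chart of the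
oriented atlas it is smooth with positive Jacobian determinant. -/
def IsOrientedParam {F : Type*} [TopologicalSpace F] [ChartedSpace (EuclideanHalfSpace 2) F]
    (φ : Plane → F) : Prop :=
  ∀ e ∈ atlas (EuclideanHalfSpace 2) F, ∀ z : Plane, φ z ∈ e.source →
    ContDiffAt ℝ ∞ (e.extend (𝓡∂ 2) ∘ φ) z ∧ 0 < (fderiv ℝ (e.extend (𝓡∂ 2) ∘ φ) z).det

/-! ### Loops and multi-loops -/

/-- A loop (closed curve) in a space. -/
structure Loop (F : Type*) [TopologicalSpace F] where
  base : F
  path : Path base base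

namespace Loop

variable {F : Type*} [TopologicalSpace F]

/-- The loop traversed backwards. -/
def rev (γ : Loop F) : Loop F := ⟨γ.base, γ.path.symm⟩

/-- The constant loop. -/
def const (a : F) : Loop F := ⟨a, Path.refl a⟩

/-- Free homotopy: a homotopy through closed curves. -/
def FreelyHomotopic (α β : Loop F) : Prop :=
  ContinuousMap.HomotopicWith (α.path : C(I, F)) (β.path : C(I, F)) (fun γ => γ 0 = γ 1)

/-- Free homotopy of unoriented loops. -/
def UnorientedHomotopic (α β : Loop F) : Prop :=
  FreelyHomotopic α β ∨ FreelyHomotopic α β.rev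

/-- A loop is contractible (trivial) if it is freely homotopic to a constant loop. -/
def Contractible (α : Loop F) : Prop := ∃ a : F, FreelyHomotopic α (const a)

/-- A loop is simple if it has no self-intersections. -/
def IsSimple (α : Loop F) : Prop :=
  ∀ s t : I, α.path s = α.path t → s = t ∨ (s = 0 ∧ t = 1) ∨ (s = 1 ∧ t = 0)

theorem FreelyHomotopic.refl (α : Loop F) : FreelyHomotopic α α :=
  ContinuousMap.HomotopicWith.refl _ (by simp)

theorem FreelyHomotopic.symm {α β : Loop F} (h : FreelyHomotopic α β) : FreelyHomotopic β α :=
  ContinuousMap.HomotopicWith.symm h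

theorem FreelyHomotopic.trans {α β γ : Loop F} (h : FreelyHomotopic α β)
    (h' : FreelyHomotopic β γ) : FreelyHomotopic α γ :=
  ContinuousMap.HomotopicWith.trans h h'

theorem FreelyHomotopic.rev {α β : Loop F} (h : FreelyHomotopic α β) :
    FreelyHomotopic α.rev β.rev := by
  obtain ⟨H⟩ := h
  refine ⟨⟨⟨⟨fun p => H (p.1, σ p.2), by fun_prop⟩, ?_, ?_⟩, ?_⟩⟩
  · intro x
    change H (0, σ x) = α.path.symm x
    rw [H.apply_zero]; rfl
  · intro x
    change H (1, σ x) = β.path.symm x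
    rw [H.apply_one]; rfl
  · intro t
    have := H.prop t
    change H (t, 0) = H (t, 1) at this
    change H (t, σ 0) = H (t, σ 1)
    simpa using this.symm

theorem rev_rev (α : Loop F) : α.rev.rev = α := by
  cases α; simp [Loop.rev]

theorem UnorientedHomotopic.refl (α : Loop F) : UnorientedHomotopic α α :=
  Or.inl (FreelyHomotopic.refl α)

theorem UnorientedHomotopic.symm {α β : Loop F} (h : UnorientedHomotopic α β) :
    UnorientedHomotopic β α := by
  rcases h with h | h
  · exact Or.inl h.symm
  · right
    have := h.rev.symm
    rwa [rev_rev] at this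

theorem UnorientedHomotopic.trans {α β γ : Loop F} (h : UnorientedHomotopic α β)
    (h' : UnorientedHomotopic β γ) : UnorientedHomotopic α γ := by
  rcases h with h | h <;> rcases h' with h' | h'
  · exact Or.inl (h.trans h')
  · exact Or.inr (h.trans h')
  · exact Or.inr (h.trans h'.rev)
  · left
    have := h.trans h'.rev
    rwa [rev_rev] at this

end Loop

/-- A (non-trivial, unoriented) multi-loop: a finite, possibly empty, collection of pairwise
disjoint simple non-contractible loops. -/
structure MultiLoop (F : Type*) [TopologicalSpace F] where
  ι : Type
  [fintype : Fintype ι]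
  loop : ι → Loop F
  simple : ∀ i, (loop i).IsSimple
  disjoint : ∀ i j, i ≠ j → Disjoint (Set.range (loop i).path) (Set.range (loop j).path)
  nontrivial : ∀ i, ¬ (loop i).Contractible

/-- Two multi-loops are identified if their components can be matched so that corresponding
components are homotopic as unoriented loops. For disjoint simple non-contractible loops on an
orientable surface this is the same as isotopy of multi-loops (Baer, Epstein). -/
instance MultiLoop.setoid (F : Type*) [TopologicalSpace F] : Setoid (MultiLoop F) where
  r M N := ∃ f : M.ι ≃ N.ι, ∀ i, (M.loop i).UnorientedHomotopic (N.loop (f i))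
  iseqv :=
    { refl := fun M => ⟨Equiv.refl _, fun i => Loop.UnorientedHomotopic.refl _⟩
      symm := by
        rintro M N ⟨f, hf⟩
        refine ⟨f.symm, fun i => ?_⟩
        have := (hf (f.symm i)).symm
        rwa [Equiv.apply_symm_apply] at this
      trans := by
        rintro M N P ⟨f, hf⟩ ⟨g, hg⟩
        exact ⟨f.trans g, fun i => (hf i).trans (hg (f i))⟩ }

/-- `MC(F)`: the set of multi-loops on `F`, up to isotopy; the empty multi-loop is included. -/
def MC (F : Type*) [TopologicalSpace F] := Quotient (MultiLoop.setoid F)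

/-! ### Link diagrams -/

/-- The points `1, i, -1, -i` of the unit circle, in counterclockwise order. -/
def corner : Fin 4 → Plane := ![!₂[1, 0], !₂[0, 1], !₂[-1, 0], !₂[0, -1]]

/-- An (unoriented) link diagram on the surface `F`: finitely many crossings, joined by arcs, and
finitely many circles without crossings.

Around the crossing `x` we fix an oriented coordinate system `disc x`, in which the diagram meets
the closed unit disc in the two coordinate segments `[-1, 1] × {0}` (the over-strand) and
`{0} × [-1, 1]` (the under-strand). The end `(x, k)` is the point `disc x (corner k)`, so that the
over-strand joins the ends `0` and `2` and the under-strand joins the ends `1` and `3`.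
Outside of the open unit discs the diagram is the disjoint union of the embedded arcs `arc e`
(from `e` to the end `nbr e`, each arc being listed once from each of its two ends) and of the
embedded circles `circ j`. -/
structure LinkDiagram (F : Type*) [TopologicalSpace F] [ChartedSpace (EuclideanHalfSpace 2) F] where
  /-- number of crossings -/
  c : ℕ
  /-- number of circles without crossings -/
  m : ℕ
  disc : Fin c → C(Plane, F)
  disc_isOpenEmbedding : ∀ x, Topology.IsOpenEmbedding (disc x)
  disc_oriented : ∀ x, IsOrientedParam (disc x)
  disc_disjoint : ∀ x y, x ≠ y →
    Disjoint (disc x '' Metric.closedBall 0 1) (disc y '' Metric.closedBall 0 1)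
  nbr : Fin c × Fin 4 → Fin c × Fin 4
  nbr_ne : ∀ e, nbr e ≠ e
  nbr_nbr : ∀ e, nbr (nbr e) = e
  arc : ∀ e : Fin c × Fin 4,
    Path (disc e.1 (corner e.2)) (disc (nbr e).1 (corner (nbr e).2))
  arc_nbr : ∀ e t, arc (nbr e) t = arc e (σ t)
  arc_injective : ∀ e, Function.Injective (arc e)
  arc_disjoint : ∀ e e', e' ≠ e → e' ≠ nbr e →
    Disjoint (Set.range (arc e)) (Set.range (arc e'))
  arc_disc : ∀ e x t, arc e t ∈ disc x '' Metric.closedBall 0 1 → t = 0 ∨ t = 1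
  circ : Fin m → Loop F
  circ_simple : ∀ j, (circ j).IsSimple
  circ_disjoint : ∀ i j, i ≠ j → Disjoint (Set.range (circ i).path) (Set.range (circ j).path)
  circ_arc : ∀ j e, Disjoint (Set.range (circ j).path) (Set.range (arc e))
  circ_disc : ∀ j x, Disjoint (Set.range (circ j).path) (disc x '' Metric.closedBall 0 1)

namespace LinkDiagram

variable {F : Type*} [TopologicalSpace F] [ChartedSpace (EuclideanHalfSpace 2) F]
variable (D : LinkDiagram F)

/-- The ends of the strands at the crossings. -/
abbrev End : Type := Fin D.c × Fin 4

/-- The point of the surface at an end. -/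
def pt (e : D.End) : F := D.disc e.1 (corner e.2)

/-- A state: a choice of an `A`-smoothing (`true`) or a `B`-smoothing (`false`) for every
crossing. -/
abbrev State : Type := Fin D.c → Bool

/-- The pure `A` state. -/
def stateA : D.State := fun _ => true

/-- The pure `B` state. -/
def stateB : D.State := fun _ => false

variable (S : D.State)

/-- The pairing of the ends at each crossing by the smoothing. The regions swept out by rotating
the over-strand counterclockwise are the quadrants between the ends `0, 1` and between the ends
`2, 3`. The `A`-smoothing merges these two, i.e. it pairs `1` with `2` and `3` with `0`. The
`B`-smoothing pairs `0` with `1` and `2` with `3`. -/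
def turn (e : D.End) : D.End := (e.1, if S e.1 then 3 - e.2 else 1 - e.2)

/-- The smoothed strand at a crossing, starting from the end `e`: a straight chord of the unit disc
in the coordinates around the crossing. -/
def chord (e : D.End) : Path (D.pt e) (D.pt (D.turn S e)) :=
  (Path.segment (corner e.2) (corner (D.turn S e).2)).map (D.disc e.1).continuous

/-- Travelling along the state from the end `e`: first along the arc of the diagram, then along the
smoothed strand at the crossing which is reached; `step S e` is the new end. -/
def step (e : D.End) : D.End := D.turn S (D.nbr e)

/-- The arc of the diagram starting from the end `e`. -/
def arcPath (e : D.End) : Path (D.pt e) (D.pt (D.nbr e)) := D.arc e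

/-- The path travelled by `step`. -/
def stepPath (e : D.End) : Path (D.pt e) (D.pt (D.step S e)) :=
  (D.arcPath e).trans (D.chord S (D.nbr e))

/-- The first `k + 1` steps, starting from the end `e`. -/
def walk (e : D.End) : (k : ℕ) → Path (D.pt e) (D.pt ((D.step S)^[k + 1] e))
  | 0 => D.stepPath S e
  | k + 1 => (walk e k).trans ((D.stepPath S ((D.step S)^[k + 1] e)).cast rfl
      (congrArg D.pt (Function.iterate_succ_apply' _ _ _)))

theorem turn_turn (e : D.End) : D.turn S (D.turn S e) = e := by
  obtain ⟨x, k⟩ := e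
  simp only [turn]
  split_ifs <;> simp

theorem turn_ne (e : D.End) : D.turn S e ≠ e := by
  obtain ⟨x, k⟩ := e
  intro h
  simp only [turn, Prod.mk.injEq, true_and] at h
  split_ifs at h <;> fin_cases k <;> simp at h

theorem step_injective : Function.Injective (D.step S) := by
  intro e e' h
  have h1 : D.nbr e = D.nbr e' := by
    have := congrArg (D.turn S) h
    simpa [step, turn_turn] using this
  have := congrArg D.nbr h1
  simpa [D.nbr_nbr] using this

/-- The number of steps after which one is back at the end `e`. -/
def period (e : D.End) : ℕ := Function.minimalPeriod (D.step S) e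

theorem period_pos (e : D.End) : 0 < D.period S e :=
  Function.minimalPeriod_pos_of_mem_periodicPts
    ((D.step_injective S).mem_periodicPts e)

/-- The loop of the state `S` through the end `e`. -/
def cycleLoop (e : D.End) : Loop F :=
  ⟨D.pt e, (D.walk S e (D.period S e - 1)).cast rfl (by
    rw [Nat.sub_add_cancel (D.period_pos S e)]
    exact congrArg D.pt (Function.iterate_minimalPeriod (f := D.step S) (x := e)).symm)⟩

/-- The loops of the state `S` which pass through crossings: the classes of ends joined by the arcs
of the diagram and the smoothed strands. -/
def Cycle : Type := Quot (fun e e' : D.End => e' = D.nbr e ∨ e' = D.turn S e)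

/-- The set of loops of the state `S`. -/
abbrev Loops : Type := D.Cycle S ⊕ Fin D.m

/-- The loops of the state `S` as curves in the surface; the choice of the starting end only affects
parametrization and direction. -/
def loopOf : D.Loops S → Loop F
  | Sum.inl q => D.cycleLoop S q.out
  | Sum.inr j => D.circ j

instance : Finite (D.Cycle S) := by unfold Cycle; infer_instance

instance : Fintype (D.Loops S) := Fintype.ofFinite _

/-! ### The loops of a state are simple and pairwise disjoint -/

theorem corner_norm (k : Fin 4) : ‖corner k‖ = 1 := by
  fin_cases k <;> simp [corner, EuclideanSpace.norm_eq]

theorem corner_mem (k : Fin 4) : corner k ∈ Metric.closedBall (0 : Plane) 1 := by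
  simp [corner_norm]

theorem corner_injective : Function.Injective corner := by
  intro k l h
  have h0 := congrArg (fun v : Plane => v 0) h
  have h1 := congrArg (fun v : Plane => v 1) h
  fin_cases k <;> fin_cases l <;> first | rfl | 
    (exfalso; norm_num [corner] at h0; done) | (exfalso; norm_num [corner] at h1)

theorem pt_injective : Function.Injective D.pt := by
  rintro ⟨x, k⟩ ⟨y, l⟩ h
  simp only [pt] at h
  by_cases hxy : x = y
  · subst hxy
    have := corner_injective ((D.disc_isOpenEmbedding x).injective h)
    rw [this]
  · exact absurd h ((D.disc_disjoint x y hxy).ne_of_mem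
      ⟨_, corner_mem k, rfl⟩ ⟨_, corner_mem l, rfl⟩)

theorem chord_mem (e : D.End) (t : I) : D.chord S e t ∈ D.disc e.1 '' Metric.closedBall 0 1 := by
  refine ⟨Path.segment (corner e.2) (corner (D.turn S e).2) t, ?_, rfl⟩
  apply (convex_closedBall (0 : Plane) 1).segment_subset (corner_mem _) (corner_mem _)
  rw [← Path.range_segment]
  exact ⟨t, rfl⟩

theorem chord_eq (e e' : D.End) (s t : I) (h : D.chord S e s = D.chord S e' t) :
    (e = e' ∧ s = t) ∨ (e' = D.turn S e ∧ t = σ s) := by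
  obtain ⟨x, k⟩ := e
  obtain ⟨y, l⟩ := e'
  by_cases hxy : x = y
  · subst hxy
    have h' : Path.segment (corner k) (corner (D.turn S (x, k)).2) s =
      Path.segment (corner l) (corner (D.turn S (x, l)).2) t :=
        (D.disc_isOpenEmbedding x).injective h
    rw [Path.segment_apply, Path.segment_apply, AffineMap.lineMap_apply_module,
      AffineMap.lineMap_apply_module] at h'
    have h0 := congrArg (fun v : Plane => v 0) h'
    have h1 := congrArg (fun v : Plane => v 1) h'
    have hs0 := s.2.1
    have hs1 := s.2.2
    have ht0 := t.2.1
    have ht1 := t.2.2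
    suffices (k = l ∧ (s : ℝ) = t) ∨ (l = (D.turn S (x, k)).2 ∧ (t : ℝ) = 1 - s) by
      rcases this with ⟨h2, h3⟩ | ⟨h2, h3⟩
      · exact Or.inl ⟨by rw [h2], Subtype.ext h3⟩
      · exact Or.inr ⟨by rw [h2]; rfl, Subtype.ext h3⟩
    simp only [turn] at h0 h1 ⊢
    cases hS : S x <;> fin_cases k <;> fin_cases l <;> simp [hS, corner] at h0 h1 ⊢ <;>
      linarith
  · exact absurd h ((D.disc_disjoint x y hxy).ne_of_mem
      (D.chord_mem S (x, k) s) (D.chord_mem S (y, l) t))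

theorem arc_eq (e e' : D.End) (s t : I) (h : D.arcPath e s = D.arcPath e' t) :
    (e = e' ∧ s = t) ∨ (e' = D.nbr e ∧ t = σ s) := by
  by_cases h1 : e' = e
  · subst h1
    exact Or.inl ⟨rfl, D.arc_injective _ h⟩
  by_cases h2 : e' = D.nbr e
  · subst h2
    have h : D.arc e s = D.arc (D.nbr e) t := h
    rw [D.arc_nbr] at h
    right
    refine ⟨rfl, ?_⟩
    rw [D.arc_injective _ h, unitInterval.symm_symm]
  · exact absurd h ((D.arc_disjoint e e' h1 h2).ne_of_mem ⟨_, rfl⟩ ⟨_, rfl⟩)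

theorem chord_zero (e : D.End) : D.chord S e 0 = D.pt e := (D.chord S e).source

theorem chord_one (e : D.End) : D.chord S e 1 = D.pt (D.turn S e) := (D.chord S e).target

theorem arc_zero (e : D.End) : D.arcPath e 0 = D.pt e := (D.arcPath e).source

theorem arc_one (e : D.End) : D.arcPath e 1 = D.pt (D.nbr e) := (D.arcPath e).target

/-- A smoothed strand contains no ends besides its own. -/
theorem chord_eq_pt (e e' : D.End) (t : I) (h : D.chord S e t = D.pt e') :
    (e' = e ∧ t = 0) ∨ (e' = D.turn S e ∧ t = 1) := by
  rw [← D.chord_zero S e'] at h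
  rcases D.chord_eq S _ _ _ _ h with ⟨h1, h2⟩ | ⟨h1, h2⟩
  · exact Or.inl ⟨h1.symm, h2⟩
  · refine Or.inr ⟨h1, ?_⟩
    rw [← unitInterval.symm_symm t, ← h2, unitInterval.symm_zero]

theorem arc_eq_chord (e e' : D.End) (s t : I) (h : D.arcPath e s = D.chord S e' t) :
    (s = 0 ∧ t = 0 ∧ e = e') ∨ (s = 0 ∧ t = 1 ∧ e = D.turn S e') ∨
    (s = 1 ∧ t = 0 ∧ D.nbr e = e') ∨ (s = 1 ∧ t = 1 ∧ D.nbr e = D.turn S e') := by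
  have hs : s = 0 ∨ s = 1 := D.arc_disc e e'.1 s (by
    change D.arcPath e s ∈ _
    rw [h]
    exact D.chord_mem S e' t)
  rcases hs with rfl | rfl
  · rw [arc_zero] at h
    rcases D.chord_eq_pt S _ _ _ h.symm with ⟨h1, h2⟩ | ⟨h1, h2⟩ <;> simp [h1, h2]
  · rw [arc_one] at h
    rcases D.chord_eq_pt S _ _ _ h.symm with ⟨h1, h2⟩ | ⟨h1, h2⟩ <;> simp [h1, h2]

theorem step_iterate_ne (k : ℕ) : ∀ e : D.End, (D.step S)^[k] e ≠ D.nbr e := by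
  induction k using Nat.twoStepInduction with
  | zero => exact fun e h => D.nbr_ne e h.symm
  | one => exact fun e h => D.turn_ne S _ h
  | more k ih _ =>
    intro e h
    rw [Function.iterate_succ_apply', Function.iterate_succ_apply] at h
    apply ih (D.step S e)
    apply D.step_injective S
    rw [h]
    simp [step, D.nbr_nbr, turn_turn]

/-- Two ends are connected if they lie on the same loop of the state. -/
def cycleOf (e : D.End) : D.Cycle S := Quot.mk _ e

theorem cycleOf_nbr (e : D.End) : D.cycleOf S (D.nbr e) = D.cycleOf S e :=
  Eq.symm (Quot.sound (r := fun e e' : D.End => e' = D.nbr e ∨ e' = D.turn S e) (Or.inl rfl))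

theorem cycleOf_turn (e : D.End) : D.cycleOf S (D.turn S e) = D.cycleOf S e :=
  Eq.symm (Quot.sound (r := fun e e' : D.End => e' = D.nbr e ∨ e' = D.turn S e) (Or.inr rfl))

theorem cycleOf_iterate (e : D.End) (k : ℕ) :
    D.cycleOf S ((D.step S)^[k] e) = D.cycleOf S e := by
  induction k with
  | zero => rfl
  | succ k ih => rw [Function.iterate_succ_apply', step, cycleOf_turn, cycleOf_nbr, ih]

/-- Every point of a step is a point of an arc or of a smoothed strand. -/
theorem stepPath_cases (e : D.End) (u : I) :
    (∃ s : I, (s : ℝ) = 2 * u ∧ D.stepPath S e u = D.arcPath e s) ∨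
    (∃ s : I, s ≠ 0 ∧ (s : ℝ) = 2 * u - 1 ∧ D.stepPath S e u = D.chord S (D.nbr e) s) := by
  have h := Path.trans_apply (D.arcPath e) (D.chord S (D.nbr e)) u
  change D.stepPath S e u = _ at h
  rw [h]
  split_ifs with h
  · exact Or.inl ⟨_, rfl, rfl⟩
  · refine Or.inr ⟨_, ?_, rfl, rfl⟩
    intro h0
    have := congrArg (Subtype.val) h0
    simp at this
    push Not at h
    linarith

theorem stepPath_cycleOf (e e' : D.End) (u v : I) (h : D.stepPath S e u = D.stepPath S e' v) :
    D.cycleOf S e = D.cycleOf S e' := by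
  rcases D.stepPath_cases S e u with ⟨s, -, hs⟩ | ⟨s, -, -, hs⟩ <;>
  rcases D.stepPath_cases S e' v with ⟨t, -, ht⟩ | ⟨t, -, -, ht⟩ <;> rw [hs, ht] at h
  · rcases D.arc_eq _ _ _ _ h with ⟨h, -⟩ | ⟨h, -⟩ <;> simp [h, cycleOf_nbr]
  · rcases D.arc_eq_chord S _ _ _ _ h with ⟨-, -, h⟩ | ⟨-, -, h⟩ | ⟨-, -, h⟩ | ⟨-, -, h⟩ <;>
      have := congrArg (D.cycleOf S) h <;> simpa [cycleOf_nbr, cycleOf_turn] using this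
  · rcases D.arc_eq_chord S _ _ _ _ h.symm with ⟨-, -, h⟩ | ⟨-, -, h⟩ | ⟨-, -, h⟩ | ⟨-, -, h⟩ <;>
      have := congrArg (D.cycleOf S) h.symm <;> simpa [cycleOf_nbr, cycleOf_turn] using this
  · rcases D.chord_eq S _ _ _ _ h with ⟨h, -⟩ | ⟨h, -⟩ <;>
      have := congrArg (D.cycleOf S) h <;>
      simpa [cycleOf_nbr, cycleOf_turn, eq_comm] using this

/-- Two steps of the same loop (travelled in the same direction) only meet at their ends. -/
theorem stepPath_eq (e : D.End) (k : ℕ) (u v : I)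
    (h : D.stepPath S e u = D.stepPath S ((D.step S)^[k] e) v) :
    ((D.step S)^[k] e = e ∧ u = v) ∨ ((D.step S)^[k] e = D.step S e ∧ u = 1 ∧ v = 0) ∨
    (D.step S ((D.step S)^[k] e) = e ∧ u = 0 ∧ v = 1) := by
  have hinj := D.step_injective S
  have hne := D.step_iterate_ne S k e
  have hne' : D.nbr ((D.step S)^[k] e) ≠ D.step S e := by
    intro h
    have h2 := congrArg D.nbr h
    rw [D.nbr_nbr] at h2
    rcases k with _ | k
    · exact D.step_iterate_ne S 1 e h.symm
    · rw [Function.iterate_succ_apply] at h2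
      exact D.step_iterate_ne S k (D.step S e) h2
  have hnbr : ∀ a b : D.End, D.nbr a = D.nbr b → a = b := by
    intro a b hab
    rw [← D.nbr_nbr a, hab, D.nbr_nbr]
  have hturn : ∀ a b : D.End, D.turn S a = D.turn S b → a = b := by
    intro a b hab
    rw [← D.turn_turn S a, hab, D.turn_turn]
  set e' := (D.step S)^[k] e with he'
  rcases D.stepPath_cases S e u with ⟨s, hsu, hs⟩ | ⟨s, hs0, hsu, hs⟩ <;>
  rcases D.stepPath_cases S e' v with ⟨t, htv, ht⟩ | ⟨t, ht0, htv, ht⟩ <;> rw [hs, ht] at h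
  · rcases D.arc_eq _ _ _ _ h with ⟨h1, h2⟩ | ⟨h1, h2⟩
    · refine Or.inl ⟨h1.symm, Subtype.ext ?_⟩
      rw [h2] at hsu
      linarith
    · exact absurd h1 hne
  · rcases D.arc_eq_chord S _ _ _ _ h with ⟨h1, h2, h3⟩ | ⟨h1, h2, h3⟩ | ⟨h1, h2, h3⟩ |
      ⟨h1, h2, h3⟩
    · exact absurd h2 ht0
    · refine Or.inr (Or.inr ⟨h3.symm, Subtype.ext ?_, Subtype.ext ?_⟩)
      · rw [h1] at hsu
        simp at hsu ⊢
        exact hsu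
      · rw [h2] at htv
        change (v : ℝ) = 1
        simp only [Set.Icc.coe_one] at htv
        linarith
    · exact absurd h2 ht0
    · exact absurd h3.symm (D.step_iterate_ne S (k + 1) e ∘ fun h4 => by
        rw [Function.iterate_succ_apply']; exact h4)
  · rcases D.arc_eq_chord S _ _ _ _ h.symm with ⟨h1, h2, h3⟩ | ⟨h1, h2, h3⟩ | ⟨h1, h2, h3⟩ |
      ⟨h1, h2, h3⟩
    · exact absurd h2 hs0
    · refine Or.inr (Or.inl ⟨h3, Subtype.ext ?_, Subtype.ext ?_⟩)
      · rw [h2] at hsu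
        change (u : ℝ) = 1
        simp only [Set.Icc.coe_one] at hsu
        linarith
      · rw [h1] at htv
        simp at htv ⊢
        exact htv
    · exact absurd h2 hs0
    · exact absurd h3 hne'
  · rcases D.chord_eq S _ _ _ _ h with ⟨h1, h2⟩ | ⟨h1, h2⟩
    · refine Or.inl ⟨(hnbr _ _ h1).symm, Subtype.ext ?_⟩
      rw [h2] at hsu
      linarith
    · exact absurd h1 hne'

theorem walk_succ (e : D.End) (k : ℕ) (u : I) :
    (∃ s : I, (s : ℝ) = 2 * u ∧ D.walk S e (k + 1) u = D.walk S e k s) ∨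
    (∃ s : I, s ≠ 0 ∧ (s : ℝ) = 2 * u - 1 ∧
      D.walk S e (k + 1) u = D.stepPath S ((D.step S)^[k + 1] e) s) := by
  rw [walk, Path.trans_apply]
  split_ifs with h
  · exact Or.inl ⟨_, rfl, rfl⟩
  · refine Or.inr ⟨_, ?_, rfl, rfl⟩
    intro h0
    have := congrArg (Subtype.val) h0
    simp at this
    push Not at h
    linarith

theorem walk_mem (e : D.End) (k : ℕ) : ∀ u : I,
    ∃ i ≤ k, ∃ s : I, D.walk S e k u = D.stepPath S ((D.step S)^[i] e) s := by
  induction k with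
  | zero => exact fun u => ⟨0, le_rfl, u, rfl⟩
  | succ k ih =>
    intro u
    rcases D.walk_succ S e k u with ⟨s, -, hs⟩ | ⟨s, -, -, hs⟩
    · obtain ⟨i, hi, t, ht⟩ := ih s
      exact ⟨i, by omega, t, hs.trans ht⟩
    · exact ⟨k + 1, le_rfl, s, hs⟩

theorem walk_zero (e : D.End) (k : ℕ) : D.walk S e k 0 = D.pt e := (D.walk S e k).source

theorem walk_injective (e : D.End) (k : ℕ) : k < D.period S e → ∀ u v : I,
    D.walk S e k u = D.walk S e k v →
      u = v ∨ (k + 1 = D.period S e ∧ ((u = 0 ∧ v = 1) ∨ (u = 1 ∧ v = 0))) := by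
  induction k with
  | zero =>
    intro hk u v h
    have h' : D.stepPath S e u = D.stepPath S ((D.step S)^[0] e) v := h
    rcases D.stepPath_eq S e 0 u v h' with ⟨-, h2⟩ | ⟨h1, h2⟩ | ⟨h1, h2⟩
    · exact Or.inl h2
    · exact Or.inr ⟨(Function.minimalPeriod_eq_one_iff_isFixedPt.2 h1.symm).symm, Or.inr h2⟩
    · exact Or.inr ⟨(Function.minimalPeriod_eq_one_iff_isFixedPt.2 h1).symm, Or.inl h2⟩
  | succ k ih =>
    intro hk
    have key : ∀ (u v s t : I), (s : ℝ) = 2 * u → t ≠ 0 → (t : ℝ) = 2 * v - 1 →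
        D.walk S e k s = D.stepPath S ((D.step S)^[k + 1] e) t →
        k + 2 = D.period S e ∧ u = 0 ∧ v = 1 := by
      intro u v s t hsu ht0 htv h
      obtain ⟨i, hi, s', hs'⟩ := D.walk_mem S e k s
      have hlt : ∀ a b : ℕ, a < D.period S e → b < D.period S e →
          (D.step S)^[a] e = (D.step S)^[b] e → a = b := fun a b ha hb hab =>
        (Function.iterate_eq_iterate_iff_of_lt_minimalPeriod ha hb).1 hab
      have hk1 : (D.step S)^[k + 1] e = (D.step S)^[k + 1 - i] ((D.step S)^[i] e) := by
        rw [← Function.iterate_add_apply, Nat.sub_add_cancel (by omega)]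
      have h2 := hs'.symm.trans h
      rw [hk1] at h2
      rcases D.stepPath_eq S _ _ _ _ h2 with ⟨h3, -⟩ | ⟨-, -, h3⟩ | ⟨h3, h4, h5⟩
      · rw [← hk1] at h3
        have := hlt _ _ (by omega) (by omega) h3
        omega
      · exact absurd h3 ht0
      · rw [← hk1, ← Function.iterate_succ_apply' (D.step S)] at h3
        have hp : k + 2 = D.period S e := by
          by_contra hne
          have := hlt (k + 2) i (by omega) (by omega) h3
          omega
        have hi0 : i = 0 := by
          refine hlt i 0 (by omega) (by omega) ?_
          rw [← h3]
          change (D.step S)^[k + 2] e = e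
          rw [hp]
          exact Function.iterate_minimalPeriod
        subst hi0
        rw [h4] at hs'
        have h6 : D.walk S e k s = D.walk S e k 0 := by
          rw [hs', walk_zero]
          exact (D.stepPath S e).source
        have hs0 : s = 0 := by
          rcases ih (by omega) _ _ h6 with h7 | ⟨h7, -⟩
          · exact h7
          · omega
        refine ⟨hp, Subtype.ext ?_, Subtype.ext ?_⟩
        · rw [hs0] at hsu
          change (u : ℝ) = 0
          simp only [Set.Icc.coe_zero] at hsu
          linarith
        · rw [h5] at htv
          change (v : ℝ) = 1
          simp only [Set.Icc.coe_one] at htv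
          linarith
    intro u v h
    rcases D.walk_succ S e k u with ⟨s, hsu, hs⟩ | ⟨s, hs0, hsu, hs⟩ <;>
    rcases D.walk_succ S e k v with ⟨t, htv, ht⟩ | ⟨t, ht0, htv, ht⟩ <;> rw [hs, ht] at h
    · rcases ih (by omega) s t h with h | ⟨h, -⟩
      · refine Or.inl (Subtype.ext ?_)
        rw [h] at hsu
        linarith
      · omega
    · obtain ⟨h1, h2, h3⟩ := key u v s t hsu ht0 htv h
      exact Or.inr ⟨h1, Or.inl ⟨h2, h3⟩⟩
    · obtain ⟨h1, h2, h3⟩ := key v u t s htv hs0 hsu h.symm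
      exact Or.inr ⟨h1, Or.inr ⟨h3, h2⟩⟩
    · rcases D.stepPath_eq S _ 0 s t h with ⟨-, h2⟩ | ⟨h1, h2⟩ | ⟨h1, h2⟩
      · refine Or.inl (Subtype.ext ?_)
        rw [h2] at hsu
        linarith
      · exact absurd h2.2 ht0
      · exact absurd h2.1 hs0

theorem cycleLoop_path (e : D.End) (u : I) :
    (D.cycleLoop S e).path u = D.walk S e (D.period S e - 1) u := rfl

theorem cycleLoop_simple (e : D.End) : (D.cycleLoop S e).IsSimple := by
  intro u v h
  rw [cycleLoop_path, cycleLoop_path] at h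
  have := D.period_pos S e
  rcases D.walk_injective S e _ (by omega) u v h with h | ⟨-, h⟩
  · exact Or.inl h
  · exact Or.inr h

theorem loopOf_simple (ℓ : D.Loops S) : (D.loopOf S ℓ).IsSimple := by
  rcases ℓ with q | j
  · exact D.cycleLoop_simple S _
  · exact D.circ_simple j

/-- The points of a loop of a state lie on arcs and smoothed strands of that loop. -/
theorem cycleLoop_mem (q : D.Cycle S) (u : I) :
    ∃ (e : D.End) (s : I), D.cycleOf S e = q ∧ (D.loopOf S (Sum.inl q)).path u =
      D.stepPath S e s := by
  obtain ⟨i, -, s, hs⟩ := D.walk_mem S (Quot.out q) (D.period S (Quot.out q) - 1) u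
  exact ⟨_, s, by rw [cycleOf_iterate]; exact Quot.out_eq q, hs⟩

theorem circ_ne_stepPath (j : Fin D.m) (u : I) (e : D.End) (s : I) :
    (D.circ j).path u ≠ D.stepPath S e s := by
  intro h
  rcases D.stepPath_cases S e s with ⟨t, -, ht⟩ | ⟨t, -, -, ht⟩ <;> rw [ht] at h
  · exact (D.circ_arc j e).ne_of_mem ⟨u, rfl⟩ ⟨t, rfl⟩ h
  · exact (D.circ_disc j (D.nbr e).1).ne_of_mem ⟨u, rfl⟩ (D.chord_mem S (D.nbr e) t) h

theorem loopOf_disjoint (ℓ ℓ' : D.Loops S) (h : ℓ ≠ ℓ') :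
    Disjoint (Set.range (D.loopOf S ℓ).path) (Set.range (D.loopOf S ℓ').path) := by
  rw [Set.disjoint_left]
  rintro _ ⟨u, rfl⟩ ⟨v, hv⟩
  rcases ℓ with q | j <;> rcases ℓ' with q' | j'
  · obtain ⟨e, s, he, hs⟩ := D.cycleLoop_mem S q u
    obtain ⟨e', s', he', hs'⟩ := D.cycleLoop_mem S q' v
    rw [hs, hs'] at hv
    exact h (by rw [← he, ← he', D.stepPath_cycleOf S _ _ _ _ hv])
  · obtain ⟨e, s, he, hs⟩ := D.cycleLoop_mem S q u
    rw [hs] at hv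
    exact D.circ_ne_stepPath S j' v e s hv
  · obtain ⟨e, s, he, hs⟩ := D.cycleLoop_mem S q' v
    rw [hs] at hv
    exact D.circ_ne_stepPath S j u e s hv.symm
  · exact (D.circ_disjoint j j' (fun hj => h (by rw [hj]))).ne_of_mem ⟨u, rfl⟩ ⟨v, rfl⟩ hv.symm

/-! ### The skein bracket -/

/-- `t(S)`: the number of contractible loops of `S`. -/
def t : ℕ := Nat.card {ℓ : D.Loops S // (D.loopOf S ℓ).Contractible}

open Classical in
/-- The loops of `S` which are not contractible, as a multi-loop. -/
def hatMultiLoop : MultiLoop F where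
  ι := {ℓ : D.Loops S // ¬ (D.loopOf S ℓ).Contractible}
  loop ℓ := D.loopOf S ℓ
  simple ℓ := D.loopOf_simple S ℓ
  disjoint ℓ ℓ' h := D.loopOf_disjoint S ℓ ℓ' (fun h' => h (Subtype.ext h'))
  nontrivial ℓ := ℓ.2

/-- `Ŝ`: the state `S` with its contractible loops removed, as an element of `MC(F)`. -/
def hat : MC F := Quotient.mk _ (D.hatMultiLoop S)

/-- `a(S)`: the number of `A`-smoothings of `S`. -/
def a : ℕ := (Finset.univ.filter (fun x => S x = true)).card

/-- `b(S)`: the number of `B`-smoothings of `S`. -/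
def b : ℕ := (Finset.univ.filter (fun x => S x = false)).card

open LaurentPolynomial in
/-- The skein bracket `[D] = ∑_S A^(a(S) - b(S)) δ^t(S) Ŝ` in `ℤ[A, A⁻¹] MC(F)`, where
`δ = - A² - A⁻²`: all crossings are resolved by the Kauffman skein relation, and contractible loops
are replaced by `δ`. -/
def bracket : MC F →₀ ℤ[T;T⁻¹] :=
  ∑ S : D.State, Finsupp.single (D.hat S)
    (T ((D.a S : ℤ) - (D.b S : ℤ)) * (-T 2 - T (-2)) ^ D.t S)

/-- Two states are adjacent if they differ at exactly one crossing. -/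
def Adjacent (S S' : D.State) : Prop := ∃! x, S x ≠ S' x

/-- `A`-adequate diagrams. -/
def IsAAdequate : Prop :=
  ∀ S : D.State, D.Adjacent S D.stateA → D.t S ≤ D.t D.stateA ∨ D.hat S ≠ D.hat D.stateA

/-- `B`-adequate diagrams. -/
def IsBAdequate : Prop :=
  ∀ S : D.State, D.Adjacent S D.stateB → D.t S ≤ D.t D.stateB ∨ D.hat S ≠ D.hat D.stateB

/-- Skein adequate diagrams. -/
def IsSkeinAdequate : Prop := D.IsAAdequate ∧ D.IsBAdequate

end LinkDiagram

open Classical in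
/-- The exponents of `A` which occur in the coefficients of an element of `ℤ[A, A⁻¹] MC(F)`. -/
def exponents {F : Type*} [TopologicalSpace F] (f : MC F →₀ ℤ[T;T⁻¹]) : Finset ℤ :=
  f.support.biUnion (fun μ => (f μ).coeff.support)

/-- The maximal degree in `A`, equal to `⊥` for the zero element. -/
def dMax {F : Type*} [TopologicalSpace F] (f : MC F →₀ ℤ[T;T⁻¹]) : WithBot ℤ :=
  (exponents f).max

/-- The minimal degree in `A`, equal to `⊤` for the zero element. -/
def dMin {F : Type*} [TopologicalSpace F] (f : MC F →₀ ℤ[T;T⁻¹]) : WithTop ℤ :=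
  (exponents f).min

/-- The span: the difference between the maximal and the minimal degree in `A` (and `0` for the
zero element). -/
def span {F : Type*} [TopologicalSpace F] (f : MC F →₀ ℤ[T;T⁻¹]) : ℤ :=
  (dMax f).unbotD 0 - (dMin f).untopD 0

end

noncomputable section

/-! ### Free homotopy and the fundamental groupoid -/

namespace Loop

open CategoryTheory

variable {F : Type*} [TopologicalSpace F]

/-! Everything rests on comparing two states `S`, `S'` that differ at one crossing `x`. Loops
avoiding the disc of `x` are the same in both. If `S'` has a single loop there, it can gain a
contractible loop over `S` only when that loop is contractible and no loop of `S` at `x` is; the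
number of essential loops then drops. If `S'` has two loops there, `S` merges them into one, whose
class is a product of the two in the fundamental groupoid; a contractible factor leaves the free
homotopy class of the other, so the essential classes agree. If neither factor is contractible, `S'`
gains nothing. Hence one change raises `t` by at most one, and a rise either preserves the essential
classes or lowers their number (`t_le_of_eq_off`).

Iterating over the crossings where `S` differs from `S₀` gives `t S ≤ t S₀ + d`, with `d` the
Hamming distance, and equality forces a rise at every change, hence no increase in the number of
essential loops. If moreover `hat S = hat S₀`, that number cannot have dropped at the first change,
so the first change kept the essential classes and raised `t`, which adequacy forbids
(`IsAdequateState.t_lt`).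

For `S₀ = stateA` one has `a - b = c - 2d`, so the top exponent `a - b + 2t` of a state is at most
`c + 2t(S_A)`. Under adequacy only `S_A` contributes to this power of `A` times its own multi-loop,
with coefficient `±1`. The minimal degree is symmetric, with `S_B`.

Topologically, conjugacy in the fundamental groupoid yields free homotopy, and the plane is simply
connected, so strands inside a crossing disc compose canonically. `Trav` records the class of a
travelled path together with its number of steps. -/

/-- The class of a loop in the fundamental groupoid. -/
def cls (α : Loop F) : FundamentalGroupoid.mk α.base ⟶ FundamentalGroupoid.mk α.base :=
  FundamentalGroupoid.fromPath (Path.Homotopic.Quotient.mk α.path)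

theorem freelyHomotopic_of_homotopic {a : F} {p q : Path a a} (h : p.Homotopic q) :
    FreelyHomotopic ⟨a, p⟩ ⟨a, q⟩ := by
  obtain ⟨H⟩ := h
  exact ⟨⟨H.toHomotopy, fun t => (H.source t).trans (H.target t).symm⟩⟩

theorem freelyHomotopic_of_coe_eq {α β : Loop F} (h : ∀ u, α.path u = β.path u) :
    FreelyHomotopic α β := by
  have : (α.path : C(I, F)) = (β.path : C(I, F)) := by
    ext u
    exact h u
  unfold FreelyHomotopic
  rw [this]
  exact FreelyHomotopic.refl β

/-- The loop which runs along the final part of `c`, starting at time `s`, then along `β`, and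
back. -/
def tailConj {a b : F} (c : Path a b) (β : Path b b) (s : I) : Path (c s) (c s) :=
  ((c.subpath s 1).trans (β.cast c.target c.target)).trans (c.subpath 1 s)

theorem continuous_tailConj {a b : F} (c : Path a b) (β : Path b b) :
    Continuous fun p : I × I => tailConj c β p.1 p.2 := by
  have h1 : Continuous fun p : I × I => c.subpath p.1 1 p.2 :=
    c.subpath_continuous_family.comp
      (by fun_prop : Continuous fun p : I × I => (p.1, (1 : I), p.2))
  have h2 : Continuous fun p : I × I => c.subpath 1 p.1 p.2 :=
    c.subpath_continuous_family.comp
      (by fun_prop : Continuous fun p : I × I => ((1 : I), p.1, p.2))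
  have h3 : Continuous fun p : I × I => (β.cast c.target c.target) p.2 := by fun_prop
  have h4 : Continuous fun p : I × I =>
      ((c.subpath p.1 1).trans (β.cast c.target c.target)) p.2 :=
    Path.trans_continuous_family (fun s : I => c.subpath s 1) h1
      (fun _ : I => β.cast c.target c.target) h3
  exact Path.trans_continuous_family
    (fun s : I => (c.subpath s 1).trans (β.cast c.target c.target)) h4
    (fun s : I => c.subpath 1 s) h2

/-- The base point slides along `c`: at time `s` only the part of `c` after `s` is run through and
back. At `s = 1` both tails are constant. -/
theorem freelyHomotopic_conj {a b : F} (c : Path a b) (β : Path b b) :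
    FreelyHomotopic ⟨a, (c.trans β).trans c.symm⟩ ⟨b, β⟩ := by
  have h01 : FreelyHomotopic ⟨c 0, tailConj c β 0⟩ ⟨c 1, tailConj c β 1⟩ :=
    ⟨⟨⟨⟨fun p => tailConj c β p.1 p.2, continuous_tailConj c β⟩, fun _ => rfl, fun _ => rfl⟩,
      fun t => (tailConj c β t).source.trans (tailConj c β t).target.symm⟩⟩
  have h0 : FreelyHomotopic ⟨a, (c.trans β).trans c.symm⟩ ⟨c 0, tailConj c β 0⟩ := by
    apply freelyHomotopic_of_coe_eq
    intro u
    have hc : c.subpath 1 0 = (c.subpath 0 1).symm := (c.symm_subpath 0 1).symm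
    simp only [tailConj, hc, Path.subpath_zero_one, Path.trans_apply, Path.cast_coe,
      Path.symm_apply]
  have h1 : FreelyHomotopic ⟨c 1, tailConj c β 1⟩ ⟨c 1, β.cast c.target c.target⟩ := by
    apply freelyHomotopic_of_homotopic
    simp only [tailConj, Path.subpath_self]
    exact ⟨(Path.Homotopy.transRefl _).trans (Path.Homotopy.reflTrans _)⟩
  exact ((h0.trans h01).trans h1).trans (freelyHomotopic_of_coe_eq fun _ => rfl)

/-- The passage from algebra to topology: the hypothesis says that `α` is `β` conjugated by `c`, and
conjugation does not affect the free homotopy class. -/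
theorem freelyHomotopic_of_cls_comp {α β : Loop F}
    (c : FundamentalGroupoid.mk α.base ⟶ FundamentalGroupoid.mk β.base)
    (h : α.cls ≫ c = c ≫ β.cls) : FreelyHomotopic α β := by
  obtain ⟨a, p⟩ := α
  obtain ⟨b, q⟩ := β
  obtain ⟨c, rfl⟩ := Path.Homotopic.Quotient.mk_surjective c
  refine FreelyHomotopic.trans ?_ (freelyHomotopic_conj c q)
  apply freelyHomotopic_of_homotopic
  apply Path.Homotopic.Quotient.exact
  let C : FundamentalGroupoid.mk a ⟶ FundamentalGroupoid.mk b :=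
    FundamentalGroupoid.fromPath (Path.Homotopic.Quotient.mk c)
  change cls ⟨a, p⟩ = (C ≫ cls ⟨b, q⟩) ≫ Groupoid.inv C
  change cls ⟨a, p⟩ ≫ C = C ≫ cls ⟨b, q⟩ at h
  rw [← h]
  simp

/-- The square swept out by the free homotopy commutes in the groupoid. Its two vertical sides are
the same track, which cancels. -/
theorem Contractible.cls_eq {α : Loop F} (h : α.Contractible) : α.cls = 𝟙 _ := by
  obtain ⟨a, ⟨H⟩⟩ := h
  have h1 := (Path.Homotopic.map_trans_evalAt H.toHomotopy
    (⟨ContinuousMap.id I, rfl, rfl⟩ : Path (0 : I) 1)).pathCast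
      (x₂ := α.base) (x₃ := a) α.path.source.symm rfl
  let c : Path α.base a := (H.toHomotopy.evalAt 0).cast α.path.source.symm rfl
  -- Every intermediate curve is closed, so the endpoints `0` and `1` move along one track.
  have hc : ∀ u, H.toHomotopy.evalAt 1 u = c u := fun u => (H.prop u).symm
  have h2 : (α.path.trans c).Homotopic (c.trans (Path.refl a)) := by
    convert! h1 using 1
    ext u
    refine (Path.trans_apply _ _ _).trans (Eq.trans ?_ (Path.trans_apply _ _ _).symm)
    split_ifs
    · rfl
    · exact (hc _).symm
  let C : FundamentalGroupoid.mk α.base ⟶ FundamentalGroupoid.mk a :=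
    FundamentalGroupoid.fromPath (Path.Homotopic.Quotient.mk c)
  have h3 : α.cls ≫ C = C ≫ 𝟙 _ := Quotient.sound h2
  rw [Category.comp_id] at h3
  exact (cancel_mono_id C).1 h3

end Loop

/-! ### Classes of the paths travelled along a state -/

namespace LinkDiagram

open CategoryTheory

variable {F : Type*} [TopologicalSpace F] [ChartedSpace (EuclideanHalfSpace 2) F]
variable (D : LinkDiagram F)

/-- An end as an object of the fundamental groupoid. -/
def ob (e : D.End) : FundamentalGroupoid F := ⟨D.pt e⟩

/-- The class of the arc from the end `e` to the end `g`. -/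
def arcCls (e g : D.End) (h : D.nbr e = g) : D.ob e ⟶ D.ob g :=
  FundamentalGroupoid.fromPath
    (Path.Homotopic.Quotient.mk ((D.arcPath e).cast rfl (congrArg D.pt h.symm)))

/-- The class of the paths inside a crossing disc which join two of its ends. -/
def discCls (x : Fin D.c) (k l : Fin 4) : D.ob (x, k) ⟶ D.ob (x, l) :=
  FundamentalGroupoid.fromPath (Path.Homotopic.Quotient.mk
    ((Path.segment (corner k) (corner l)).map (D.disc x).continuous))

@[simp]
-- Both sides are images of paths in the plane, which is simply connected.
theorem discCls_comp (x : Fin D.c) (k l m : Fin 4) :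
    D.discCls x k l ≫ D.discCls x l m = D.discCls x k m := by
  apply Quotient.sound
  have h := (SimplyConnectedSpace.paths_homotopic
    ((Path.segment (corner k) (corner l)).trans (Path.segment (corner l) (corner m)))
    (Path.segment (corner k) (corner m))).map (D.disc x)
  rwa [Path.map_trans] at h

@[simp]
theorem discCls_comp_assoc (x : Fin D.c) (k l m : Fin 4) {Z : FundamentalGroupoid F}
    (f : D.ob (x, m) ⟶ Z) :
    D.discCls x k l ≫ D.discCls x l m ≫ f = D.discCls x k m ≫ f := by
  rw [← Category.assoc, discCls_comp]

@[simp]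
theorem discCls_self (x : Fin D.c) (k : Fin 4) : D.discCls x k k = 𝟙 _ := by
  have h := D.discCls_comp x k k k
  rwa [← cancel_mono (D.discCls x k k), Category.id_comp]

theorem inv_discCls (x : Fin D.c) (k l : Fin 4) :
    inv (D.discCls x k l) = D.discCls x l k := by
  rw [← cancel_epi (D.discCls x k l)]
  simp

/-- Each arc is listed from both of its ends, with reversed parametrization, so the two representing
paths agree on the nose. -/
theorem inv_arcCls (e g : D.End) (h : D.nbr e = g) (h' : D.nbr g = e) :
    D.arcCls g e h' = Groupoid.inv (D.arcCls e g h) := by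
  subst h
  change _ = FundamentalGroupoid.fromPath (Path.Homotopic.Quotient.mk (D.arcPath e).symm)
  unfold arcCls
  congr 2
  ext u
  exact D.arc_nbr e u

/-! ### Groupoid classes of paths travelled along a state -/

/-- `Trav S e e' p n`: travelling `n` steps along the state `S` from the end `e`, one reaches the
end `e'` along a path of class `p`. -/
inductive Trav (S : D.State) : (e e' : D.End) → (D.ob e ⟶ D.ob e') → ℕ → Prop
  | nil (e : D.End) : Trav S e e (𝟙 _) 0
  | cons {e e' : D.End} {x : Fin D.c} {l m : Fin 4} {p : D.ob (x, m) ⟶ D.ob e'} {n : ℕ}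
      (h : D.nbr e = (x, l)) (h' : D.turn S (x, l) = (x, m)) (hp : Trav S (x, m) e' p n) :
      Trav S e e' (D.arcCls e (x, l) h ≫ D.discCls x l m ≫ p) (n + 1)

variable {D} {S S' : D.State}

theorem Trav.single {e : D.End} {x : Fin D.c} {l m : Fin 4} (h : D.nbr e = (x, l))
    (h' : D.turn S (x, l) = (x, m)) :
    D.Trav S e (x, m) (D.arcCls e (x, l) h ≫ D.discCls x l m) 1 := by
  simpa using Trav.cons h h' (Trav.nil _)

theorem Trav.append {e e' e'' : D.End} {p : D.ob e ⟶ D.ob e'} {q : D.ob e' ⟶ D.ob e''} {n m : ℕ}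
    (hp : D.Trav S e e' p n) (hq : D.Trav S e' e'' q m) : D.Trav S e e'' (p ≫ q) (n + m) := by
  induction hp with
  | nil e => simpa using hq
  | cons h h' _ ih =>
    have := Trav.cons h h' (ih hq)
    simpa [Nat.add_right_comm] using this

theorem Trav.eq_iterate {e e' : D.End} {p : D.ob e ⟶ D.ob e'} {n : ℕ} (hp : D.Trav S e e' p n) :
    e' = (D.step S)^[n] e := by
  induction hp with
  | nil e => rfl
  | cons h h' _ ih => rw [ih, Function.iterate_succ_apply, step, h, h']

/-- Travelling is deterministic. Classes of loops are computed by building a traversal of the right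
length and comparing it with `trav_cycleLoop`. -/
theorem Trav.unique {e e' : D.End} {p q : D.ob e ⟶ D.ob e'} {n : ℕ} (hp : D.Trav S e e' p n)
    (hq : D.Trav S e e' q n) : p = q := by
  induction hp with
  | nil e => cases hq; rfl
  | cons h h' _ ih =>
    cases hq with
    | cons k k' hq =>
      obtain ⟨rfl, rfl⟩ := Prod.mk.inj (h.symm.trans k)
      obtain ⟨-, rfl⟩ := Prod.mk.inj (h'.symm.trans k')
      rw [ih hq]

/-- Splitting off the last step. -/
theorem Trav.exists_last {e e' : D.End} {p : D.ob e ⟶ D.ob e'} {n : ℕ}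
    (hp : D.Trav S e e' p (n + 1)) :
    ∃ (f : D.End) (q : D.ob e ⟶ D.ob f) (r : D.ob f ⟶ D.ob e'),
      D.Trav S e f q n ∧ D.Trav S f e' r 1 ∧ p = q ≫ r := by
  induction n generalizing e with
  | zero => exact ⟨e, 𝟙 _, p, Trav.nil _, hp, by simp⟩
  | succ n ih =>
    cases hp with
    | cons h h' hp =>
      obtain ⟨f, q, r, hq, hr, rfl⟩ := ih hp
      exact ⟨f, _, r, Trav.cons h h' hq, hr, by simp⟩

/-- Rotating a closed path. -/
theorem Trav.rotate {e : D.End} {p : D.ob e ⟶ D.ob e} {n : ℕ} (hp : D.Trav S e e p (n + 1)) :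
    ∃ (q : D.ob (D.step S e) ⟶ D.ob (D.step S e)) (s : D.ob e ⟶ D.ob (D.step S e)),
      D.Trav S (D.step S e) (D.step S e) q (n + 1) ∧ p ≫ s = s ≫ q := by
  cases hp with
  | @cons _ _ x l m p n h h' hp =>
    have hs : D.step S e = (x, m) := by rw [step, h, h']
    rw [hs]
    exact ⟨_, D.arcCls e _ h ≫ D.discCls x l m, hp.append (Trav.single h h'), by simp⟩

/-- Travelling backwards. -/
theorem Trav.reverse {e e' : D.End} {p : D.ob e ⟶ D.ob e'} {n : ℕ} (hp : D.Trav S e e' p n) :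
    D.Trav S (D.nbr e') (D.nbr e)
      (Groupoid.inv (D.arcCls e' _ rfl) ≫ Groupoid.inv p ≫ D.arcCls e _ rfl) n := by
  induction hp with
  | nil e => simpa using Trav.nil (D.nbr e)
  | @cons e e' x l m q n h h' _ ih =>
    -- The target `g` stays a variable, since `D.nbr e` occurs in the types and could not be
    -- replaced by `(x, l)` directly.
    have key : ∀ (g : D.End) (hg : D.nbr e = g), D.Trav S (D.nbr (x, m)) g
        (Groupoid.inv (D.arcCls (x, m) _ rfl) ≫ D.discCls x m l ≫
          Groupoid.inv (D.arcCls e (x, l) h) ≫ D.arcCls e g hg) 1 := by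
      intro g hg
      have h1 : D.turn S (x, m) = (x, l) := by rw [← h', turn_turn]
      have h2 := Trav.single (D.nbr_nbr (x, m)) h1
      rw [D.inv_arcCls (x, m) _ rfl] at h2
      obtain rfl : g = (x, l) := hg.symm.trans h
      simpa using h2
    simpa [inv_discCls] using ih.append (key _ rfl)

theorem trav_stepPath (e e' : D.End) (h : e' = D.step S e) :
    D.Trav S e e' (FundamentalGroupoid.fromPath (Path.Homotopic.Quotient.mk
      ((D.stepPath S e).cast rfl (congrArg D.pt h)))) 1 := by
  subst h
  exact Trav.single (x := (D.nbr e).1) (l := (D.nbr e).2) (m := (D.turn S (D.nbr e)).2) rfl rfl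

theorem trav_walk (e : D.End) (k : ℕ) : ∀ (e' : D.End) (h : e' = (D.step S)^[k + 1] e),
    D.Trav S e e' (FundamentalGroupoid.fromPath (Path.Homotopic.Quotient.mk
      ((D.walk S e k).cast rfl (congrArg D.pt h)))) (k + 1) := by
  induction k with
  | zero => exact fun e' h => trav_stepPath e e' h
  | succ k ih =>
    rintro e' rfl
    exact (ih _ rfl).append (trav_stepPath _ _ (Function.iterate_succ_apply' _ _ _))

/-- The class of a loop of a state. -/
theorem trav_cycleLoop (e : D.End) : D.Trav S e e (D.cycleLoop S e).cls (D.period S e) := by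
  have hp := Nat.sub_add_cancel (D.period_pos S e)
  have h := trav_walk (S := S) e (D.period S e - 1) e (by
    rw [hp]; exact (Function.iterate_minimalPeriod (f := D.step S) (x := e)).symm)
  exact Eq.mp (congrArg (fun n => D.Trav S e e (D.cycleLoop S e).cls n) hp) h

theorem Trav.period_le {e : D.End} {p : D.ob e ⟶ D.ob e} {n : ℕ} (hp : D.Trav S e e p n)
    (hn : 0 < n) : D.period S e ≤ n :=
  Function.IsPeriodicPt.minimalPeriod_le hn hp.eq_iterate.symm

/-- Moving the start by one step conjugates the class by that step. -/
theorem freelyHomotopic_step (e : D.End) :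
    (D.cycleLoop S e).FreelyHomotopic (D.cycleLoop S (D.step S e)) := by
  have h := trav_cycleLoop (S := S) e
  have hper : D.period S (D.step S e) = D.period S e :=
    Function.minimalPeriod_apply ((D.step_injective S).mem_periodicPts e)
  obtain ⟨n, hn⟩ := Nat.exists_eq_succ_of_ne_zero (D.period_pos S e).ne'
  rw [hn] at h
  obtain ⟨q, s, hq, hs⟩ := h.rotate
  have h' := trav_cycleLoop (S := S) (D.step S e)
  rw [hper, hn] at h'
  obtain rfl := hq.unique h'
  exact Loop.freelyHomotopic_of_cls_comp s hs

theorem period_nbr (e : D.End) : D.period S (D.nbr e) = D.period S e := by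
  have key : ∀ e : D.End, D.period S (D.nbr e) ≤ D.period S e := fun e =>
    (trav_cycleLoop e).reverse.period_le (D.period_pos S e)
  apply le_antisymm (key e)
  have := key (D.nbr e)
  rwa [D.nbr_nbr] at this

/-- Starting from the other end of the first arc traverses the same loop backwards, up to
conjugation by that arc. -/
theorem unorientedHomotopic_nbr (e : D.End) :
    (D.cycleLoop S (D.nbr e)).UnorientedHomotopic (D.cycleLoop S e) := by
  have h := (trav_cycleLoop (S := S) e).reverse
  rw [← period_nbr] at h
  have h' := h.unique (trav_cycleLoop (D.nbr e))
  right
  refine Loop.freelyHomotopic_of_cls_comp (Groupoid.inv (D.arcCls e _ rfl)) ?_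
  change (D.cycleLoop S (D.nbr e)).cls ≫ _ = _ ≫ Groupoid.inv (D.cycleLoop S e).cls
  refine (congrArg (fun z => z ≫ Groupoid.inv (D.arcCls e _ rfl)) h').symm.trans ?_
  have key : ∀ (a : D.ob e ⟶ D.ob (D.nbr e)) (p : D.ob e ⟶ D.ob e),
      (Groupoid.inv a ≫ p ≫ a) ≫ Groupoid.inv a = Groupoid.inv a ≫ p := by simp
  exact key _ _

/-- It suffices to treat the generators of the relation; `turn` is `step` after `nbr`. Hence the
representative chosen by `Quot.out` is immaterial. -/
theorem unorientedHomotopic_of_cycleOf_eq {e e' : D.End} (h : D.cycleOf S e = D.cycleOf S e') :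
    (D.cycleLoop S e).UnorientedHomotopic (D.cycleLoop S e') := by
  have h1 := Quot.eqvGen_exact h
  induction h1 with
  | rel e e' h1 =>
    rcases h1 with rfl | rfl
    · exact (unorientedHomotopic_nbr e).symm
    · have h2 := freelyHomotopic_step (S := S) (D.nbr e)
      rw [step, D.nbr_nbr] at h2
      exact (unorientedHomotopic_nbr e).symm.trans (Or.inl h2)
  | refl e => exact Loop.UnorientedHomotopic.refl _
  | symm e e' _ ih => exact (ih h.symm).symm
  | trans e e' e'' h1 h2 ih1 ih2 => exact 
    (ih1 (Quot.eqvGen_sound h1)).trans (ih2 (Quot.eqvGen_sound h2))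

end LinkDiagram

/-! ### Changing the smoothing of a crossing -/

namespace LinkDiagram

open CategoryTheory

variable {F : Type*} [TopologicalSpace F] [ChartedSpace (EuclideanHalfSpace 2) F]
variable {D : LinkDiagram F} {S S' : D.State} {x : Fin D.c}

theorem turn_congr {e : D.End} (h : S e.1 = S' e.1) : D.turn S e = D.turn S' e := by
  simp only [turn, h]

theorem Trav.congr {e e' : D.End} {p : D.ob e ⟶ D.ob e'} {n : ℕ} (hp : D.Trav S' e e' p n)
    (hS : ∀ y, y ≠ x → S y = S' y) (h : ∀ i < n, (D.nbr ((D.step S')^[i] e)).1 ≠ x) :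
    D.Trav S e e' p n := by
  induction hp with
  | nil e => exact Trav.nil e
  | @cons e e' y l m p n h1 h2 _ ih =>
    have hy : y ≠ x := by simpa [h1] using h 0 (by omega)
    refine Trav.cons h1 ((turn_congr (hS y hy)).trans h2) (ih fun i hi => ?_)
    have := h (i + 1) (by omega)
    rwa [Function.iterate_succ_apply, step, h1, h2] at this

theorem iterate_step_congr {e : D.End} {n : ℕ} (hS : ∀ y, y ≠ x → S y = S' y)
    (h : ∀ i < n, (D.nbr ((D.step S')^[i] e)).1 ≠ x) :
    (D.step S)^[n] e = (D.step S')^[n] e := by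
  induction n with
  | zero => rfl
  | succ n ih =>
    rw [Function.iterate_succ_apply', Function.iterate_succ_apply',
      ih fun i hi => h i (by omega)]
    exact turn_congr (hS _ (h n (by omega)))

/-- A loop which passes through the disc of `x` only once, along the strand from `k` to `k'`, until
the last moment also is a path of a state which differs at `x`. -/
theorem reconnect {k k' m : Fin 4} (hS : ∀ y, y ≠ x → S y = S' y)
    (h1 : D.turn S' (x, k) = (x, k')) (h2 : D.turn S (x, k') = (x, m))
    (hsep : ∀ l, D.cycleOf S' (x, l) = D.cycleOf S' (x, k) → l = k ∨ l = k')
    {p : D.ob (x, k) ⟶ D.ob (x, k)} (hp : D.Trav S' (x, k) (x, k) p (D.period S' (x, k))) :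
    D.Trav S (x, k) (x, m) (p ≫ D.discCls x k m) (D.period S' (x, k)) ∧
      ∀ i < D.period S' (x, k), (D.step S)^[i] (x, k) = (D.step S')^[i] (x, k) := by
  obtain ⟨n, hn⟩ := Nat.exists_eq_succ_of_ne_zero (D.period_pos S' (x, k)).ne'
  have h1' : D.turn S' (x, k') = (x, k) := by rw [← h1, turn_turn]
  -- The disc of `x` is entered only at the last step: arriving at `(x, k)` would mean meeting the
  -- loop in the opposite direction, and arriving at `(x, k')` would close it before its period.
  have hout : ∀ i < n, (D.nbr ((D.step S')^[i] (x, k))).1 ≠ x := by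
    intro i hi hx
    have hl : D.nbr ((D.step S')^[i] (x, k)) = (x, (D.nbr ((D.step S')^[i] (x, k))).2) :=
      Prod.ext hx rfl
    have hc : D.cycleOf S' (D.nbr ((D.step S')^[i] (x, k))) = D.cycleOf S' (x, k) := by
      rw [cycleOf_nbr, cycleOf_iterate]
    rw [hl] at hc
    rcases hsep _ hc with h | h
    · rw [h] at hl
      have h3 := congrArg D.nbr hl
      rw [D.nbr_nbr] at h3
      exact D.step_iterate_ne S' i _ h3
    · rw [h] at hl
      have h3 : (D.step S')^[i + 1] (x, k) = (x, k) := by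
        rw [Function.iterate_succ_apply', step, hl, h1']
      have := Function.IsPeriodicPt.minimalPeriod_le (f := D.step S') (Nat.succ_pos i) h3
      change D.period S' (x, k) ≤ i + 1 at this
      omega
  rw [hn] at hp ⊢
  obtain ⟨f, q, r, hq, hr, rfl⟩ := hp.exists_last
  refine ⟨?_, fun i hi => iterate_step_congr hS fun j hj => hout j (by omega)⟩
  have hf : D.nbr f = (x, k') := by
    have h3 := hr.eq_iterate
    change (x, k) = D.turn S' (D.nbr f) at h3
    rw [← D.turn_turn S' (D.nbr f), ← h3, h1]
  obtain rfl := hr.unique (Trav.single hf h1')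
  simpa using (hq.congr hS hout).append (Trav.single hf h2)

/-- Ends `0` and `2` lie on different strands of either smoothing, and the partner of one in `S'` is
the partner of the other in `S`. So a path leaving at `0` and returning at `k` continues in `S` from
`2`. -/
theorem turn_of_ne (h : S x ≠ S' x) : ∃ k k' : Fin 4,
    D.turn S' (x, 0) = (x, k) ∧ D.turn S (x, k) = (x, 2) ∧
    D.turn S' (x, 2) = (x, k') ∧ D.turn S (x, k') = (x, 0) ∧
    ∀ l : Fin 4, l = 0 ∨ l = 2 ∨ l = k ∨ l = k' := by
  cases hS' : S' x
  · have hS : S x = true := by simpa [hS'] using h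
    refine ⟨1, 3, ?_, ?_, ?_, ?_, by decide⟩ <;> simp [turn, hS, hS']
  · have hS : S x = false := by simpa [hS'] using h
    refine ⟨3, 1, ?_, ?_, ?_, ?_, by decide⟩ <;> simp [turn, hS, hS']

/-- If the state `S'` has two loops in the disc of `x`, then these are merged in the state which
differs at `x`. -/
theorem merge_of_cycleOf_ne (hS : ∀ y, y ≠ x → S y = S' y) (hx : S x ≠ S' x)
    (hsep : D.cycleOf S' (x, 0) ≠ D.cycleOf S' (x, 2)) :
    D.cycleOf S (x, 0) = D.cycleOf S (x, 2) ∧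
    ∀ (p : D.ob (x, 0) ⟶ D.ob (x, 0)) (q : D.ob (x, 2) ⟶ D.ob (x, 2)),
      D.Trav S' (x, 0) (x, 0) p (D.period S' (x, 0)) →
      D.Trav S' (x, 2) (x, 2) q (D.period S' (x, 2)) →
      D.Trav S (x, 0) (x, 0) ((p ≫ D.discCls x 0 2) ≫ q ≫ D.discCls x 2 0)
        (D.period S (x, 0)) := by
  obtain ⟨k, k', h1, h2, h3, h4, hall⟩ := turn_of_ne hx
  have hk : D.cycleOf S' (x, k) = D.cycleOf S' (x, 0) := by rw [← h1, cycleOf_turn]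
  have hk' : D.cycleOf S' (x, k') = D.cycleOf S' (x, 2) := by rw [← h3, cycleOf_turn]
  have hsep0 : ∀ l, D.cycleOf S' (x, l) = D.cycleOf S' (x, 0) → l = 0 ∨ l = k := by
    intro l hl
    rcases hall l with rfl | rfl | rfl | rfl
    · exact Or.inl rfl
    · exact absurd hl.symm hsep
    · exact Or.inr rfl
    · exact absurd (hl.symm.trans hk') hsep
  have hsep2 : ∀ l, D.cycleOf S' (x, l) = D.cycleOf S' (x, 2) → l = 2 ∨ l = k' := by
    intro l hl
    rcases hall l with rfl | rfl | rfl | rfl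
    · exact absurd hl hsep
    · exact Or.inl rfl
    · exact absurd (hk.symm.trans hl) hsep
    · exact Or.inr rfl
  have key0 := fun p hp => reconnect (p := p) hS h1 h2 hsep0 hp
  have key2 := fun q hq => reconnect (p := q) hS h3 h4 hsep2 hq
  obtain ⟨ht0, hi0⟩ := key0 _ (trav_cycleLoop (x, 0))
  obtain ⟨ht2, hi2⟩ := key2 _ (trav_cycleLoop (x, 2))
  -- The concatenated path closes up, and not earlier: within the first stretch that would
  -- contradict the minimality of the first period, within the second it would put both ends on one
  -- loop of `S'`.
  have hper : D.period S (x, 0) = D.period S' (x, 0) + D.period S' (x, 2) := by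
    have hle := (ht0.append ht2).period_le (by have := D.period_pos S' (x, 0); omega)
    by_contra hne
    have hper := Function.iterate_minimalPeriod (f := D.step S) (x := (x, 0))
    change (D.step S)^[D.period S (x, 0)] (x, 0) = (x, 0) at hper
    have hpos := D.period_pos S (x, 0)
    rcases lt_or_ge (D.period S (x, 0)) (D.period S' (x, 0)) with hlt | hge
    · rw [hi0 _ hlt] at hper
      have := Function.IsPeriodicPt.minimalPeriod_le (f := D.step S') hpos hper
      exact absurd this (not_le.2 hlt)
    · obtain ⟨i, hi⟩ := Nat.exists_eq_add_of_le' hge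
      rw [hi, Function.iterate_add_apply, ← ht0.eq_iterate, hi2 i (by omega)] at hper
      apply hsep
      rw [← hper, cycleOf_iterate]
  refine ⟨?_, fun p q hp hq => ?_⟩
  · rw [ht0.eq_iterate, cycleOf_iterate]
  · rw [hper]
    exact (key0 p hp).1.append (key2 q hq).1

/-- The trivial factor disappears from the product, leaving the second loop conjugated by a path in
the disc. -/
theorem freelyHomotopic_of_contractible_left (hS : ∀ y, y ≠ x → S y = S' y) (hx : S x ≠ S' x)
    (hsep : D.cycleOf S' (x, 0) ≠ D.cycleOf S' (x, 2))
    (h : (D.cycleLoop S' (x, 0)).Contractible) :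
    (D.cycleLoop S (x, 0)).FreelyHomotopic (D.cycleLoop S' (x, 2)) := by
  have h1 := trav_cycleLoop (S := S') (x, 0)
  rw [h.cls_eq] at h1
  have h2 := (merge_of_cycleOf_ne hS hx hsep).2 _ _ h1 (trav_cycleLoop (x, 2))
  refine Loop.freelyHomotopic_of_cls_comp (D.discCls x 0 2) ?_
  have key : ∀ q : D.ob (x, 2) ⟶ D.ob (x, 2),
      ((𝟙 (D.ob (x, 0)) ≫ D.discCls x 0 2) ≫ q ≫ D.discCls x 2 0) ≫ D.discCls x 0 2 =
        D.discCls x 0 2 ≫ q := by simp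
  rw [(trav_cycleLoop (x, 0)).unique h2]
  exact key _

theorem freelyHomotopic_of_contractible_right (hS : ∀ y, y ≠ x → S y = S' y) (hx : S x ≠ S' x)
    (hsep : D.cycleOf S' (x, 0) ≠ D.cycleOf S' (x, 2))
    (h : (D.cycleLoop S' (x, 2)).Contractible) :
    (D.cycleLoop S (x, 0)).FreelyHomotopic (D.cycleLoop S' (x, 0)) := by
  have h1 := trav_cycleLoop (S := S') (x, 2)
  rw [h.cls_eq] at h1
  have h2 := (merge_of_cycleOf_ne hS hx hsep).2 _ _ (trav_cycleLoop (x, 0)) h1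
  refine Loop.freelyHomotopic_of_cls_comp (𝟙 (D.ob (x, 0))) ?_
  have key : ∀ p : D.ob (x, 0) ⟶ D.ob (x, 0),
      ((p ≫ D.discCls x 0 2) ≫ 𝟙 (D.ob (x, 2)) ≫ D.discCls x 2 0) ≫ 𝟙 _ = 𝟙 _ ≫ p := by simp
  rw [(trav_cycleLoop (x, 0)).unique h2]
  exact key _

end LinkDiagram

/-! ### Multisets of classes of loops -/

/-- Equal multisets mean fibres of equal cardinality, and bijections of the fibres glue. -/
theorem exists_equiv_iff_map_univ_eq {ι κ γ : Type*} [Fintype ι] [Fintype κ] (f : ι → γ)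
    (g : κ → γ) :
    (∃ e : ι ≃ κ, ∀ i, f i = g (e i)) ↔
      (Finset.univ : Finset ι).val.map f = (Finset.univ : Finset κ).val.map g := by
  classical
  constructor
  · rintro ⟨e, he⟩
    rw [← Multiset.map_univ_val_equiv e, Multiset.map_map]
    exact Multiset.map_congr rfl fun i _ => he i
  · intro h
    have key : ∀ c, Nonempty ({i // f i = c} ≃ {j // g j = c}) := fun c => by
      rw [← Fintype.card_eq, Fintype.card_subtype, Fintype.card_subtype]
      have h1 := congrArg (Multiset.count c) h
      simp only [Multiset.count_map] at h1
      simpa [Finset.card_def, eq_comm] using h1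
    exact ⟨Equiv.ofFiberEquiv fun c => (key c).some, fun i => (Equiv.ofFiberEquiv_map _ i).symm⟩

/-- The instance on the sum is arbitrary because `Loops` carries the one from `Fintype.ofFinite`. -/
theorem map_univ_sum {α β γ : Type*} [Fintype α] [Fintype β] [inst : Fintype (α ⊕ β)]
    (f : α ⊕ β → γ) :
    (Finset.univ : Finset (α ⊕ β)).val.map f =
      (Finset.univ : Finset α).val.map (f ∘ Sum.inl) +
        (Finset.univ : Finset β).val.map (f ∘ Sum.inr) := by
  rw [Subsingleton.elim inst (instFintypeSum α β), ← Finset.univ_disjSum_univ, Finset.val_disjSum,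
    Multiset.disjSum, Multiset.map_add, Multiset.map_map, Multiset.map_map]

/-! ### Unoriented free homotopy classes -/

namespace Loop

variable {F : Type*} [TopologicalSpace F]

theorem Contractible.of_unorientedHomotopic {α β : Loop F} (h : α.Contractible)
    (h' : α.UnorientedHomotopic β) : β.Contractible := by
  obtain ⟨a, ha⟩ := h
  rcases h' with h' | h'
  · exact ⟨a, h'.symm.trans ha⟩
  · have h1 := (h'.symm.trans ha).rev
    rw [rev_rev] at h1
    have h2 : (const a).rev = const a := by simp [rev, const]
    exact ⟨a, h2 ▸ h1⟩

/-- Homotopy of unoriented loops as an equivalence relation. -/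
def unorientedSetoid (F : Type*) [TopologicalSpace F] : Setoid (Loop F) where
  r := UnorientedHomotopic
  iseqv := ⟨UnorientedHomotopic.refl, UnorientedHomotopic.symm, UnorientedHomotopic.trans⟩

/-- Loops up to homotopy of unoriented loops. -/
def Class (F : Type*) [TopologicalSpace F] : Type _ := Quotient (unorientedSetoid F)

/-- The class of a loop up to homotopy of unoriented loops. -/
def toClass (α : Loop F) : Class F := Quotient.mk (unorientedSetoid F) α

theorem toClass_eq_iff {α β : Loop F} : α.toClass = β.toClass ↔ α.UnorientedHomotopic β :=
  Quotient.eq (r := unorientedSetoid F)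

/-- The class of contractible loops. -/
def Class.Contractible (κ : Class F) : Prop :=
  Quotient.lift Loop.Contractible (fun _ _ (h : UnorientedHomotopic _ _) => propext
    ⟨fun h' => h'.of_unorientedHomotopic h, fun h' => h'.of_unorientedHomotopic h.symm⟩) κ

@[simp]
theorem contractible_toClass (α : Loop F) : α.toClass.Contractible ↔ α.Contractible := Iff.rfl

end Loop

/-! ### The multiset of loop classes of a state -/

namespace LinkDiagram

variable {F : Type*} [TopologicalSpace F] [ChartedSpace (EuclideanHalfSpace 2) F]
variable (D : LinkDiagram F) (S : D.State)

/-- The classes of all loops of a state. -/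
def classes : Multiset (Loop.Class F) :=
  (Finset.univ : Finset (D.Loops S)).val.map fun ℓ => (D.loopOf S ℓ).toClass

open Classical in
/-- The classes of the loops of a state which are not contractible. -/
def essentialClasses : Multiset (Loop.Class F) :=
  (D.classes S).filter fun κ => ¬ κ.Contractible

open Classical in
theorem t_eq_countP : D.t S = (D.classes S).countP Loop.Class.Contractible := by
  rw [t, classes, Multiset.countP_map, Nat.card_eq_fintype_card, Fintype.card_subtype]
  rfl

/-- Matching components up to homotopy is equality of multisets of classes, so states can be
compared by counting. -/
theorem hat_eq_iff {S S' : D.State} :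
    D.hat S = D.hat S' ↔ D.essentialClasses S = D.essentialClasses S' := by
  classical
  have key : ∀ S : D.State, D.essentialClasses S =
      (Finset.univ : Finset {ℓ : D.Loops S // ¬ (D.loopOf S ℓ).Contractible}).val.map
        fun ℓ => (D.loopOf S ℓ.1).toClass := by
    intro S
    rw [essentialClasses, classes, Multiset.filter_map]
    have h1 : Multiset.filter ((fun κ : Loop.Class F => ¬ κ.Contractible) ∘
        fun ℓ => (D.loopOf S ℓ).toClass) (Finset.univ : Finset (D.Loops S)).val =
        ((Finset.univ : Finset {ℓ : D.Loops S // ¬ (D.loopOf S ℓ).Contractible}).map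
          (Function.Embedding.subtype _)).val := by
      rw [← Finset.filter_val]
      congr 1
      ext ℓ
      simp
    rw [h1, Finset.map_val, Multiset.map_map]
    rfl
  rw [key, key, ← exists_equiv_iff_map_univ_eq]
  refine Quotient.eq.trans ?_
  exact exists_congr fun f => forall_congr' fun i => Loop.toClass_eq_iff.symm

/-- The class of the loop of the state `S` through the end `e`. -/
def classAt (e : D.End) : Loop.Class F := (D.cycleLoop S e).toClass

variable {D S} {S' : D.State} {x : Fin D.c}

theorem classAt_eq {e e' : D.End} (h : D.cycleOf S e = D.cycleOf S e') :
    D.classAt S e = D.classAt S e' :=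
  Loop.toClass_eq_iff.2 (unorientedHomotopic_of_cycleOf_eq h)

theorem classAt_out (e : D.End) : D.classAt S (D.cycleOf S e).out = D.classAt S e :=
  classAt_eq (Quot.out_eq _)

/-! ### Loops through and away from one crossing -/

variable (S x) in
/-- The ends on loops which pass through the disc of `x`. -/
def Meets (e : D.End) : Prop := ∃ k, D.cycleOf S e = D.cycleOf S (x, k)

theorem Meets.congr {e e' : D.End} (h : D.Meets S x e) (h' : D.cycleOf S e' = D.cycleOf S e) :
    D.Meets S x e' := by
  obtain ⟨k, hk⟩ := h
  exact ⟨k, h'.trans hk⟩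

/-- Generators of the relation away from `x` are common to both states; one at `x` joins two ends
that lie in the disc of `x`. -/
theorem cycleOf_transfer (hS : ∀ y, y ≠ x → S y = S' y) {e e' : D.End}
    (h : D.cycleOf S e = D.cycleOf S e') :
    D.cycleOf S' e = D.cycleOf S' e' ∨ (D.Meets S' x e ∧ D.Meets S' x e') := by
  induction Quot.eqvGen_exact h with
  | rel e e' h1 =>
    rcases h1 with rfl | rfl
    · exact Or.inl (cycleOf_nbr _ _ _).symm
    · by_cases hx : e.1 = x
      · subst hx
        exact Or.inr ⟨⟨e.2, rfl⟩, ⟨(D.turn S e).2, rfl⟩⟩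
      · rw [turn_congr (hS _ hx)]
        exact Or.inl (cycleOf_turn _ _ _).symm
  | refl e => exact Or.inl rfl
  | symm e e' _ ih =>
    rcases ih h.symm with h1 | ⟨h1, h2⟩
    · exact Or.inl h1.symm
    · exact Or.inr ⟨h2, h1⟩
  | trans e e' e'' h1 h2 ih1 ih2 =>
    rcases ih1 (Quot.eqvGen_sound h1) with h3 | ⟨h3, h4⟩ <;>
    rcases ih2 (Quot.eqvGen_sound h2) with h5 | ⟨h5, h6⟩
    · exact Or.inl (h3.trans h5)
    · exact Or.inr ⟨h5.congr h3, h6⟩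
    · exact Or.inr ⟨h3, h4.congr h5.symm⟩
    · exact Or.inr ⟨h3, h6⟩

theorem Meets.transfer (hS : ∀ y, y ≠ x → S y = S' y) {e : D.End} (h : D.Meets S x e) :
    D.Meets S' x e := by
  obtain ⟨k, hk⟩ := h
  rcases cycleOf_transfer hS hk with h | ⟨h, -⟩
  · exact ⟨k, h⟩
  · exact h

theorem classAt_transfer (hS : ∀ y, y ≠ x → S y = S' y) {e : D.End} (h : ¬ D.Meets S' x e) :
    D.classAt S e = D.classAt S' e := by
  have hout : ∀ i, (D.nbr ((D.step S')^[i] e)).1 ≠ x := by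
    intro i hi
    refine h ⟨(D.nbr ((D.step S')^[i] e)).2, ?_⟩
    rw [← hi]
    change _ = D.cycleOf S' (D.nbr ((D.step S')^[i] e))
    rw [cycleOf_nbr, cycleOf_iterate]
  have hper : D.period S e = D.period S' e := by
    rw [period, period, Function.minimalPeriod_eq_minimalPeriod_iff]
    intro n
    rw [Function.IsPeriodicPt, Function.IsPeriodicPt, Function.IsFixedPt, Function.IsFixedPt,
      iterate_step_congr hS fun i _ => hout i]
  have h1 := (trav_cycleLoop (S := S') e).congr hS fun i _ => hout i
  rw [← hper] at h1
  apply Loop.toClass_eq_iff.2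
  left
  refine Loop.freelyHomotopic_of_cls_comp (CategoryTheory.CategoryStruct.id (D.ob e)) ?_
  rw [(trav_cycleLoop (S := S) e).unique h1]
  exact (CategoryTheory.Category.comp_id _).trans (CategoryTheory.Category.id_comp _).symm

instance : Fintype (D.Cycle S) := Fintype.ofFinite _

open Classical in
variable (S x) in
/-- The loops which pass through the disc of `x`. -/
def cyclesAt : Finset (D.Cycle S) := {D.cycleOf S (x, 0), D.cycleOf S (x, 2)}

/-- Each of the ends `1` and `3` is joined by a smoothed strand to `0` or `2`, so these two
represent all loops at `x`. -/
theorem mem_cyclesAt (e : D.End) : D.cycleOf S e ∈ cyclesAt S x ↔ D.Meets S x e := by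
  simp only [cyclesAt, Finset.mem_insert, Finset.mem_singleton]
  constructor
  · rintro (h | h)
    · exact ⟨0, h⟩
    · exact ⟨2, h⟩
  · rintro ⟨k, hk⟩
    rw [hk]
    have h1 := D.cycleOf_turn S (x, 1)
    have h3 := D.cycleOf_turn S (x, 3)
    simp only [turn] at h1 h3
    fin_cases k
    · exact Or.inl rfl
    · cases hS : S x
      · exact Or.inl (by simpa [hS] using h1.symm)
      · exact Or.inr (by simpa [hS] using h1.symm)
    · exact Or.inr rfl
    · cases hS : S x
      · exact Or.inr (by simpa [hS] using h3.symm)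
      · exact Or.inl (by simpa [hS] using h3.symm)

open Classical in
variable (S x) in
/-- The classes of the loops which do not pass through the disc of `x`. -/
def outerClasses : Multiset (Loop.Class F) :=
  ((Finset.univ : Finset (D.Cycle S)) \ cyclesAt S x).val.map (fun q => D.classAt S q.out) +
    (Finset.univ : Finset (Fin D.m)).val.map fun j => (D.circ j).toClass

variable (S x) in
theorem classes_eq : D.classes S =
    outerClasses S x + (cyclesAt S x).val.map fun q => D.classAt S q.out := by
  classical
  rw [classes, map_univ_sum, outerClasses, add_right_comm, ← Multiset.map_add]
  have : (Finset.univ \ cyclesAt S x).val + (cyclesAt S x).val =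
      (Finset.univ : Finset (D.Cycle S)).val := by
    rw [Finset.sdiff_val]
    exact tsub_add_cancel_of_le (Finset.val_le_iff.2 (Finset.subset_univ _))
  rw [this]
  rfl

/-- A loop avoiding `x` corresponds to the loop of the other state through the same end, and its
class is unchanged. -/
theorem outerClasses_eq (hS : ∀ y, y ≠ x → S y = S' y) :
    outerClasses S x = outerClasses S' x := by
  classical
  have hS' : ∀ y, y ≠ x → S' y = S y := fun y hy => (hS y hy).symm
  have hmem : ∀ (S : D.State) (q : D.Cycle S),
      q ∈ ((Finset.univ : Finset (D.Cycle S)) \ cyclesAt S x).val ↔ ¬ D.Meets S x q.out := by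
    intro S q
    rw [Finset.mem_val, Finset.mem_sdiff, ← mem_cyclesAt]
    have : D.cycleOf S q.out = q := Quot.out_eq q
    simp [this]
  have hout : ∀ (S : D.State) (q : D.Cycle S), D.cycleOf S q.out = q := fun S q => Quot.out_eq q
  unfold outerClasses
  congr 1
  refine Multiset.map_eq_map_of_bij_of_nodup _ _ (Finset.nodup _) (Finset.nodup _)
    (fun q _ => D.cycleOf S' q.out) ?_ ?_ ?_ ?_
  · intro q hq
    rw [hmem] at hq ⊢
    exact fun h => hq ((h.congr (hout _ _).symm).transfer hS')
  · intro q hq q' hq' h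
    rw [hmem] at hq
    rcases cycleOf_transfer hS' h with h | h
    · rw [hout, hout] at h
      exact h
    · exact absurd h.1 hq
  · intro q hq
    rw [hmem] at hq
    have hq' : ¬ D.Meets S x q.out := fun h => hq (h.transfer hS)
    refine ⟨D.cycleOf S q.out, ?_, ?_⟩
    · rw [hmem]
      exact fun h => hq' (h.congr (hout _ _).symm)
    · rcases cycleOf_transfer hS (hout S (D.cycleOf S q.out)) with h | h
      · exact h.trans (hout _ _)
      · exact absurd h.2 hq
  · intro q hq
    rw [hmem] at hq
    have hq' : ¬ D.Meets S' x q.out := fun h => hq (h.transfer hS')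
    rw [classAt_out, classAt_transfer hS hq']

open Classical in
/-- Changing one smoothing increases the number of contractible loops by at most one; if it does
so, then either the essential loops do not change or their number drops. -/
theorem t_le_of_eq_off (hS : ∀ y, y ≠ x → S y = S' y) (hx : S x ≠ S' x) :
    D.t S' ≤ D.t S + 1 ∧ (D.t S' = D.t S + 1 →
      D.essentialClasses S' = D.essentialClasses S ∨
        (D.essentialClasses S').card < (D.essentialClasses S).card) := by
  simp only [t_eq_countP, essentialClasses]
  rw [classes_eq S x, classes_eq S' x, outerClasses_eq hS]
  generalize outerClasses S' x = O
  by_cases hsep : D.cycleOf S' (x, 0) = D.cycleOf S' (x, 2)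
  -- One loop `A` of `S'` faces at least one loop `B` of `S`. A gain forces `A` contractible and `B`
  -- essential, so the essential count drops.
  · obtain ⟨q, hq⟩ : ∃ q, cyclesAt S' x = {q} := ⟨_, by simp [cyclesAt, hsep]; rfl⟩
    obtain ⟨q', hq'⟩ : ∃ q', q' ∈ (cyclesAt S x).val := ⟨D.cycleOf S (x, 0), by simp [cyclesAt]⟩
    obtain ⟨R, hR⟩ := Multiset.exists_cons_of_mem hq'
    rw [hq, hR]
    simp only [Finset.singleton_val, Multiset.map_cons,
      ← Multiset.cons_zero, Multiset.add_cons]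
    generalize D.classAt S' q.out = A
    generalize D.classAt S q'.out = B
    generalize R.map (fun q => D.classAt S q.out) = R
    by_cases hA : A.Contractible <;> by_cases hB : B.Contractible <;> simp [hA, hB] <;> omega
  · have h1 : (cyclesAt S x).val = {D.cycleOf S (x, 0)} := by
      simp [cyclesAt, (merge_of_cycleOf_ne hS hx hsep).1]
    have h2 : (cyclesAt S' x).val = {D.cycleOf S' (x, 0), D.cycleOf S' (x, 2)} := by
      rw [cyclesAt, Finset.insert_val_of_notMem (by simpa using hsep)]
      rfl
    have hl : (D.classAt S' (x, 0)).Contractible → D.classAt S (x, 0) = D.classAt S' (x, 2) :=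
      fun h => Loop.toClass_eq_iff.2 (Or.inl (freelyHomotopic_of_contractible_left hS hx hsep h))
    have hr : (D.classAt S' (x, 2)).Contractible → D.classAt S (x, 0) = D.classAt S' (x, 0) :=
      fun h => Loop.toClass_eq_iff.2 (Or.inl (freelyHomotopic_of_contractible_right hS hx hsep h))
    rw [h1, h2]
    simp only [Multiset.insert_eq_cons, Multiset.map_cons, classAt_out,
      ← Multiset.cons_zero, Multiset.add_cons]
    generalize D.classAt S (x, 0) = A at *
    generalize D.classAt S' (x, 0) = B at *
    generalize D.classAt S' (x, 2) = C at *
    -- Here `B` and `C` of `S'` merge into `A`. A contractible factor gives a gain with unchanged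
    -- essential classes; two essential factors give no gain.
    by_cases hB : B.Contractible
    · obtain rfl := hl hB
      by_cases hC : A.Contractible <;> simp [hB, hC]
    · by_cases hC : C.Contractible
      · obtain rfl := hr hC
        simp [hB, hC]
      · by_cases hA : A.Contractible <;> simp [hA, hB, hC] <;> omega

end LinkDiagram

namespace LinkDiagram

/-! ### Adequate states -/

variable {F : Type*} [TopologicalSpace F] [ChartedSpace (EuclideanHalfSpace 2) F]
variable {D : LinkDiagram F}

/-- Induction over the crossings where the states differ. Equality in the total bound forces
equality at each change, and none of these increases the number of essential loops. -/
theorem t_le_add_hammingDist (S₀ S : D.State) :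
    D.t S ≤ D.t S₀ + hammingDist S S₀ ∧ (D.t S = D.t S₀ + hammingDist S S₀ →
      (D.essentialClasses S).card ≤ (D.essentialClasses S₀).card) := by
  induction hd : hammingDist S S₀ generalizing S with
  | zero =>
    obtain rfl := hammingDist_eq_zero.1 hd
    simp
  | succ d ih =>
    obtain ⟨x, hx⟩ := Function.ne_iff.1 (hammingDist_pos.1 (by omega : 0 < hammingDist S S₀))
    have hd' : hammingDist (Function.update S x (S₀ x)) S₀ = d := by
      have : (Finset.univ.filter fun y => Function.update S x (S₀ x) y ≠ S₀ y) =
          (Finset.univ.filter fun y => S y ≠ S₀ y).erase x := by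
        ext y
        by_cases hy : y = x
        · subst hy; simp
        · simp [hy]
      rw [hammingDist, this, Finset.card_erase_of_mem (by simpa using hx)]
      change hammingDist S S₀ - 1 = d
      omega
    obtain ⟨h1, h2⟩ := ih _ hd'
    obtain ⟨h3, h4⟩ := t_le_of_eq_off (S := Function.update S x (S₀ x)) (S' := S) (x := x)
      (fun y hy => by simp [hy]) (by simpa using hx.symm)
    refine ⟨by omega, fun h => ?_⟩
    refine le_trans ?_ (h2 (by omega))
    rcases h4 (by omega) with h5 | h5
    · rw [h5]
    · exact h5.le

/-- A state `S₀` is adequate if a state with one other smoothing which has more contractible loops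
has other essential loops. -/
def IsAdequateState (S₀ : D.State) : Prop :=
  ∀ S : D.State, D.Adjacent S S₀ → D.t S ≤ D.t S₀ ∨ D.hat S ≠ D.hat S₀

/-- Adequacy only concerns neighbours of `S₀`; the essential count propagates it to all states. -/
theorem IsAdequateState.t_lt {S₀ S : D.State} (h₀ : IsAdequateState S₀) (hS : S ≠ S₀) :
    D.t S < D.t S₀ + hammingDist S S₀ ∨ D.hat S ≠ D.hat S₀ := by
  obtain ⟨x, hx⟩ := Function.ne_iff.1 hS
  set S₁ := Function.update S₀ x (S x) with hS₁
  have hadj : D.Adjacent S₁ S₀ := by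
    refine ⟨x, by simpa [hS₁] using hx, fun y hy => ?_⟩
    by_contra hne
    simp [hS₁, hne] at hy
  have hd : hammingDist S S₁ + 1 = hammingDist S S₀ := by
    have : (Finset.univ.filter fun y => S y ≠ S₁ y) =
        (Finset.univ.filter fun y => S y ≠ S₀ y).erase x := by
      ext y
      by_cases hy : y = x
      · subst hy; simp [hS₁]
      · simp [hy, hS₁]
    have hpos := hammingDist_pos.2 hS
    rw [hammingDist, this, Finset.card_erase_of_mem (by simpa using hx)]
    change hammingDist S S₀ - 1 + 1 = hammingDist S S₀
    omega
  obtain ⟨h1, h2⟩ := t_le_add_hammingDist S₁ S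
  obtain ⟨h3, h4⟩ := t_le_of_eq_off (S := S₀) (S' := S₁) (x := x)
    (fun y hy => by simp [hS₁, hy]) (by simpa [hS₁] using hx.symm)
  rcases lt_or_ge (D.t S) (D.t S₀ + hammingDist S S₀) with hlt | hge
  · exact Or.inl hlt
  right
  intro hhat
  -- Equality holds both from `S₀` to `S₁` and from `S₁` to `S`. As `S` and `S₀` have equal
  -- essential classes, `S₁` has no fewer essential loops than `S₀`, which excludes a drop at the
  -- first change.
  have h5 := h2 (by omega)
  rw [D.hat_eq_iff.1 hhat] at h5
  rcases h4 (by omega) with h6 | h6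
  · rcases h₀ S₁ hadj with h7 | h7
    · omega
    · exact h7 (D.hat_eq_iff.2 h6)
  · omega

theorem a_add_b (S : D.State) : D.a S + D.b S = D.c := by
  have := Finset.card_filter_add_card_filter_not (s := (Finset.univ : Finset (Fin D.c)))
    (fun x => S x = true)
  simpa [a, b] using this

theorem b_eq_hammingDist (S : D.State) : D.b S = hammingDist S D.stateA := by
  simp [b, hammingDist, stateA]

theorem a_eq_hammingDist (S : D.State) : D.a S = hammingDist S D.stateB := by
  simp [a, hammingDist, stateB]

/-- Each `B`-smoothing lowers `a - b` by two and raises `2t` by at most two. -/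
theorem maxExponent_le (S : D.State) :
    (D.a S : ℤ) - D.b S + 2 * D.t S ≤ D.c + 2 * D.t D.stateA := by
  have h1 := a_add_b S
  have h2 := (t_le_add_hammingDist D.stateA S).1
  rw [← b_eq_hammingDist] at h2
  omega

theorem le_minExponent (S : D.State) :
    -(D.c : ℤ) - 2 * D.t D.stateB ≤ (D.a S : ℤ) - D.b S - 2 * D.t S := by
  have h1 := a_add_b S
  have h2 := (t_le_add_hammingDist D.stateB S).1
  rw [← a_eq_hammingDist] at h2
  omega

theorem IsAAdequate.maxExponent_lt (h : D.IsAAdequate) {S : D.State} (hS : S ≠ D.stateA) :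
    (D.a S : ℤ) - D.b S + 2 * D.t S < D.c + 2 * D.t D.stateA ∨ D.hat S ≠ D.hat D.stateA := by
  have h1 := a_add_b S
  refine (IsAdequateState.t_lt h hS).imp_left fun h2 => ?_
  rw [← b_eq_hammingDist] at h2
  omega

theorem IsBAdequate.lt_minExponent (h : D.IsBAdequate) {S : D.State} (hS : S ≠ D.stateB) :
    -(D.c : ℤ) - 2 * D.t D.stateB < (D.a S : ℤ) - D.b S - 2 * D.t S ∨
      D.hat S ≠ D.hat D.stateB := by
  have h1 := a_add_b S
  refine (IsAdequateState.t_lt h hS).imp_left fun h2 => ?_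
  rw [← a_eq_hammingDist] at h2
  omega

end LinkDiagram

/-! ### Exponents of the bracket -/

open LaurentPolynomial in
/-- The monomial `A ^ n` times `δ ^ t`. -/
def stateTerm (n : ℤ) (t : ℕ) : ℤ[T;T⁻¹] := T n * (-T 2 - T (-2)) ^ t

/-- Splitting off one factor `δ` shifts the exponent by `±2`, the recursion behind the coefficient
computations. -/
theorem stateTerm_succ (n : ℤ) (t : ℕ) :
    stateTerm n (t + 1) = -stateTerm (n + 2) t - stateTerm (n - 2) t := by
  simp only [stateTerm, sub_eq_add_neg n 2, LaurentPolynomial.T_add]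
  ring

theorem coeff_stateTerm_succ (n m : ℤ) (t : ℕ) : (stateTerm n (t + 1)).coeff m =
    -(stateTerm (n + 2) t).coeff m - (stateTerm (n - 2) t).coeff m := by
  rw [stateTerm_succ]
  simp

theorem coeff_stateTerm_of_lt {n m : ℤ} {t : ℕ} (h : n + 2 * t < m) :
    (stateTerm n t).coeff m = 0 := by
  induction t generalizing n with
  | zero => simp [stateTerm]; push_cast at h; omega
  | succ t ih =>
    push_cast at h
    rw [coeff_stateTerm_succ, ih (by linarith), ih (by linarith)]
    simp

theorem coeff_stateTerm_of_gt {n m : ℤ} {t : ℕ} (h : m < n - 2 * t) :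
    (stateTerm n t).coeff m = 0 := by
  induction t generalizing n with
  | zero => simp [stateTerm]; push_cast at h; omega
  | succ t ih =>
    push_cast at h
    rw [coeff_stateTerm_succ, ih (by linarith), ih (by linarith)]
    simp

/-- The top power arises only by choosing `-A²` in every factor `δ`. -/
theorem coeff_stateTerm_top {n m : ℤ} {t : ℕ} (h : m = n + 2 * t) :
    (stateTerm n t).coeff m = (-1) ^ t := by
  induction t generalizing n with
  | zero => simp [stateTerm]; push_cast at h; omega
  | succ t ih =>
    push_cast at h
    rw [coeff_stateTerm_succ, ih (by linarith), coeff_stateTerm_of_lt (by linarith)]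
    ring

theorem coeff_stateTerm_bot {n m : ℤ} {t : ℕ} (h : m = n - 2 * t) :
    (stateTerm n t).coeff m = (-1) ^ t := by
  induction t generalizing n with
  | zero => simp [stateTerm]; push_cast at h; omega
  | succ t ih =>
    push_cast at h
    rw [coeff_stateTerm_succ, coeff_stateTerm_of_gt (by linarith), ih (by linarith)]
    ring

theorem mem_exponents {F : Type*} [TopologicalSpace F] {f : MC F →₀ ℤ[T;T⁻¹]} {m : ℤ} :
    m ∈ exponents f ↔ ∃ μ, (f μ).coeff m ≠ 0 := by
  simp only [exponents, Finset.mem_biUnion, Finsupp.mem_support_iff]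
  refine exists_congr fun μ => and_iff_right_of_imp fun h h' => h ?_
  rw [h']
  simp

/-! ### Extreme coefficients of the bracket -/

namespace LinkDiagram

variable {F : Type*} [TopologicalSpace F] [ChartedSpace (EuclideanHalfSpace 2) F]
variable {D : LinkDiagram F}

open Classical in
theorem coeff_bracket (μ : MC F) (m : ℤ) : (D.bracket μ).coeff m =
    ∑ S : D.State, if D.hat S = μ then
      (stateTerm ((D.a S : ℤ) - (D.b S : ℤ)) (D.t S)).coeff m else 0 := by
  rw [bracket, Finsupp.finsetSum_apply, AddMonoidAlgebra.coeff_sum, Finsupp.finsetSum_apply]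
  refine Finset.sum_congr rfl fun S _ => ?_
  rw [Finsupp.single_apply]
  split_ifs
  · rfl
  · simp

theorem exists_state_of_mem_exponents {m : ℤ} (h : m ∈ exponents D.bracket) :
    ∃ S : D.State, (stateTerm ((D.a S : ℤ) - (D.b S : ℤ)) (D.t S)).coeff m ≠ 0 := by
  classical
  obtain ⟨μ, hμ⟩ := mem_exponents.1 h
  rw [coeff_bracket] at hμ
  obtain ⟨S, -, hS⟩ := Finset.exists_ne_zero_of_sum_ne_zero hμ
  exact ⟨S, (ite_ne_right_iff.1 hS).2⟩

theorem le_of_mem_exponents {m : ℤ} (h : m ∈ exponents D.bracket) :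
    m ≤ D.c + 2 * D.t D.stateA := by
  obtain ⟨S, hS⟩ := exists_state_of_mem_exponents h
  by_contra hlt
  exact hS (coeff_stateTerm_of_lt (lt_of_le_of_lt (maxExponent_le S) (not_le.1 hlt)))

theorem ge_of_mem_exponents {m : ℤ} (h : m ∈ exponents D.bracket) :
    -(D.c : ℤ) - 2 * D.t D.stateB ≤ m := by
  obtain ⟨S, hS⟩ := exists_state_of_mem_exponents h
  by_contra hlt
  exact hS (coeff_stateTerm_of_gt (lt_of_lt_of_le (not_le.1 hlt) (le_minExponent S)))

/-- At the multi-loop of `S_A` no other state reaches this exponent, so the coefficient is `±1` and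
cannot cancel. -/
theorem IsAAdequate.mem_exponents (h : D.IsAAdequate) :
    (D.c : ℤ) + 2 * D.t D.stateA ∈ exponents D.bracket := by
  classical
  refine _root_.mem_exponents.2 ⟨D.hat D.stateA, ?_⟩
  rw [coeff_bracket, Finset.sum_eq_single_of_mem D.stateA (Finset.mem_univ _), if_pos rfl,
    coeff_stateTerm_top]
  · exact pow_ne_zero _ (by norm_num)
  · simp [a, b, stateA]
  · intro S _ hS
    rcases h.maxExponent_lt hS with h1 | h1
    · rw [coeff_stateTerm_of_lt h1, ite_self]
    · rw [if_neg h1]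

theorem IsBAdequate.mem_exponents (h : D.IsBAdequate) :
    -(D.c : ℤ) - 2 * D.t D.stateB ∈ exponents D.bracket := by
  classical
  refine _root_.mem_exponents.2 ⟨D.hat D.stateB, ?_⟩
  rw [coeff_bracket, Finset.sum_eq_single_of_mem D.stateB (Finset.mem_univ _), if_pos rfl,
    coeff_stateTerm_bot]
  · exact pow_ne_zero _ (by norm_num)
  · simp [a, b, stateB]
  · intro S _ hS
    rcases h.lt_minExponent hS with h1 | h1
    · rw [coeff_stateTerm_of_gt h1, ite_self]
    · rw [if_neg h1]

theorem dMax_bracket_le : dMax D.bracket ≤ ((D.c + 2 * D.t D.stateA : ℤ) : WithBot ℤ) :=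
  Finset.max_le fun _ hm => WithBot.coe_le_coe.2 (le_of_mem_exponents hm)

theorem le_dMin_bracket : ((-(D.c : ℤ) - 2 * D.t D.stateB : ℤ) : WithTop ℤ) ≤ dMin D.bracket :=
  Finset.le_min fun _ hm => WithTop.coe_le_coe.2 (ge_of_mem_exponents hm)

theorem IsAAdequate.dMax_bracket (h : D.IsAAdequate) :
    dMax D.bracket = ((D.c + 2 * D.t D.stateA : ℤ) : WithBot ℤ) :=
  le_antisymm dMax_bracket_le (Finset.le_max h.mem_exponents)

theorem IsBAdequate.dMin_bracket (h : D.IsBAdequate) :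
    dMin D.bracket = ((-(D.c : ℤ) - 2 * D.t D.stateB : ℤ) : WithTop ℤ) :=
  le_antisymm (Finset.min_le h.mem_exponents) le_dMin_bracket

theorem span_bracket_le :
    span D.bracket ≤ 2 * (D.c : ℤ) + 2 * (D.t D.stateA : ℤ) + 2 * (D.t D.stateB : ℤ) := by
  unfold span dMax dMin
  rcases (exponents D.bracket).eq_empty_or_nonempty with h | h
  -- With no exponents the default values give span `0`, and the bound is nonnegative.
  · rw [h]
    simp
    positivity
  · rw [← Finset.coe_max' h, ← Finset.coe_min' h]
    have h1 := le_of_mem_exponents (Finset.max'_mem _ h)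
    have h2 := ge_of_mem_exponents (Finset.min'_mem _ h)
    simp only [WithBot.unbotD_coe, WithTop.untopD_coe]
    linarith

end LinkDiagram

end

theorem mainTheorem8 {F : Type*} [TopologicalSpace F] [T2Space F] [SecondCountableTopology F]
    [ChartedSpace (EuclideanHalfSpace 2) F] [OrientedSurface F] (D : LinkDiagram F) :
    -- the maximal degree
    (dMax D.bracket ≤ (((D.c : ℤ) + 2 * (D.t D.stateA : ℤ) : ℤ) : WithBot ℤ) ∧
      (D.IsAAdequate →
        dMax D.bracket = (((D.c : ℤ) + 2 * (D.t D.stateA : ℤ) : ℤ) : WithBot ℤ))) ∧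
    -- the minimal degree
    ((((-(D.c : ℤ) - 2 * (D.t D.stateB : ℤ) : ℤ) : WithTop ℤ) ≤ dMin D.bracket) ∧
      (D.IsBAdequate →
        dMin D.bracket = ((-(D.c : ℤ) - 2 * (D.t D.stateB : ℤ) : ℤ) : WithTop ℤ))) ∧
    -- the span
    (span D.bracket ≤
        2 * (D.c : ℤ) + 2 * (D.t D.stateA : ℤ) + 2 * (D.t D.stateB : ℤ) ∧
      (D.IsSkeinAdequate →
        span D.bracket =
          2 * (D.c : ℤ) + 2 * (D.t D.stateA : ℤ) + 2 * (D.t D.stateB : ℤ))) ∧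
    -- the extreme terms of an adequate diagram are contributed by one state only
    (D.IsAAdequate → ∀ S : D.State, (∃ x, S x = false) →
      (D.a S : ℤ) - (D.b S : ℤ) + 2 * (D.t S : ℤ) < (D.c : ℤ) + 2 * (D.t D.stateA : ℤ) ∨
        D.hat S ≠ D.hat D.stateA) ∧
    (D.IsBAdequate → ∀ S : D.State, (∃ x, S x = true) →
      -(D.c : ℤ) - 2 * (D.t D.stateB : ℤ) < (D.a S : ℤ) - (D.b S : ℤ) - 2 * (D.t S : ℤ) ∨
        D.hat S ≠ D.hat D.stateB) := by

  refine ⟨⟨LinkDiagram.dMax_bracket_le, fun h => h.dMax_bracket⟩,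
    ⟨LinkDiagram.le_dMin_bracket, fun h => h.dMin_bracket⟩,
    ⟨LinkDiagram.span_bracket_le, fun h => ?_⟩, fun h S hS => h.maxExponent_lt ?_,
    fun h S hS => h.lt_minExponent ?_⟩
  · rw [span, h.1.dMax_bracket, h.2.dMin_bracket, WithBot.unbotD_coe, WithTop.untopD_coe]
    ring
  · rintro rfl
    obtain ⟨x, hx⟩ := hS
    exact absurd hx (by simp [LinkDiagram.stateA])
  · rintro rfl
    obtain ⟨x, hx⟩ := hS
    exact absurd hx (by simp [LinkDiagram.stateB])
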